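/- Consider $n\ge 1$ links $\ell_i=(s_i,r_i)$ (sender, receiver) in the Euclidean plane, normalized so that $\min_{i,j}d(s_i,r_j)=1$; let $\Delta=\max_i d(s_i,r_i)$. Fix a path-loss exponent $\alpha>0$ and an SINR threshold $\beta>1$; let $N\ge 0$ be the background noise and $P_{\max}\ge 1$ an integer. In the game with power control and interference cancellation (PIC) every link chooses a power $P_i\in\{0,1,\dots,P_{\max}\}$, and $s_i$ is received at $r_j$ with strength $P_{i,j}=P_i/d(s_i,r_j)^\alpha$. Receiver $r_j$ decodes $s_i$ if $P_{i,j}>0$, $P_{i,j}\ge\beta\bigl(N+\sum_{k\ne i,\ P_{k,j}\le P_{i,j}}P_{k,j}\bigr)$, and $r_j$ decodes every $s_k$ with $P_{k,j}>P_{i,j}$. Link $\ell_j$ is successful if $r_j$ decodes $s_j$. A link has utility $0$ if it chooses power $0$, $1$ if it is successful, and $-1$ if it transmits without success. A history is a finite nonempty sequence of strategy profiles; the regret of a link in it is its average utility under the best fixed strategy in hindsight (the others playing as in the history) minus its actual average utility. An $\epsilon$-regret history is one in which every link has regret at most $\epsilon$; its value is the number of successful links averaged over the rounds. Let $OPT^{PIC}(L)$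 be the maximum number of simultaneously successful links over all power profiles. The price of total anarchy $\mathrm{PoTA}_\epsilon(L)$ is the ratio of $OPT^{PIC}(L)$ to the infimum of the values of all $\epsilon$-regret histories. Theorem. The price of total anarchy with PIC is $\Theta(\log(\Delta\cdot P_{\max}))$, in the following sense. For all $\alpha>0$ and $\beta>1$ there are constants $C,c,\kappa>0$, depending only on $\alpha$ and $\beta$, such that: (Upper bound) for every set $L$ of $n$ links, every $N\ge0$, every integer $P_{\max}\ge1$ and every $0\le\epsilon\le\kappa/n$, $$\mathrm{PoTA}_\epsilon(L)\le C\,(1+\log(\Delta\cdot P_{\max})).$$ (Lower bound) for every real $\Delta\ge1$ and every integer $P_{\max}\ge1$ there is a set $L$ of pairwise distinct links whose maximal link length is $\Delta$ such that, with noise $N=0$ and for every $\epsilon\ge0$, $$\mathrm{PoTA}_\epsilon(L)\ge c\,(1+\log(\Delta\cdot P_{\max})).$$ (The summand $1$ matters only when $\Delta\cdot P_{\max}$ is close to $1$, where the logarithm vanishes while the price is at least of constant order.) -/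

import Mathlib

open scoped ENNReal

noncomputable section

namespace Wireless

/-- The Euclidean plane. -/
abbrev Plane : Type := EuclideanSpace ℝ (Fin 2)

/-- `n` sender-receiver links in the plane, with distances normalized so that the smallest
distance between any sender and any receiver is `1`. (In particular `n ≥ 1`.) -/
structure LinkSet (n : ℕ) where
  /-- the sender of each link -/
  sender : Fin n → Plane
  /-- the receiver of each link -/
  receiver : Fin n → Plane
  one_le_dist : ∀ i j, 1 ≤ dist (sender i) (receiver j)
  exists_dist_eq_one : ∃ i j, dist (sender i) (receiver j) = 1

variable {n : ℕ}

/-- The link `i`, as a sender-receiver pair. -/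
def LinkSet.link (L : LinkSet n) (i : Fin n) : Plane × Plane := (L.sender i, L.receiver i)

/-- The maximal link length `Δ`. By the normalization this is the ratio of the length of the longest
link to the minimum sender-receiver distance. -/
def LinkSet.Delta (L : LinkSet n) : ℝ := ⨆ i, dist (L.sender i) (L.receiver i)

/-- A strategy profile with power control: each link chooses an integer power in
`{0, 1, …, Pmax}`, where `0` means that it does not transmit. -/
abbrev Profile (n Pmax : ℕ) : Type := Fin n → Fin (Pmax + 1)

variable {Pmax : ℕ}

/-- The strength `P_i / d(s_i, r_j) ^ α` with which the signal of sender `i` arrives at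
receiver `j`. -/
def received (L : LinkSet n) (α : ℝ) (a : Profile n Pmax) (i j : Fin n) : ℝ :=
  ((a i : ℕ) : ℝ) / dist (L.sender i) (L.receiver j) ^ α

open Classical in
/-- Interference cancellation: receiver `j` decodes the (nonzero) signal of sender `i` if that signal
has signal-to-interference-plus-noise ratio at least `β` against all other signals that are not
stronger than it, and `j` decodes every signal that is strictly stronger (so that those have been
cancelled before). Two equally strong signals interfere with each other. -/
inductive Decodes (L : LinkSet n) (α β noise : ℝ) (a : Profile n Pmax) (j : Fin n) : Fin n → Prop
  | intro (i : Fin n)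
      (pos : 0 < received L α a i j)
      (sinr : β * ((∑ k with k ≠ i ∧ received L α a k j ≤ received L α a i j,
        received L α a k j) + noise) ≤ received L α a i j)
      (stronger : ∀ k, received L α a i j < received L α a k j → Decodes L α β noise a j k) :
      Decodes L α β noise a j i

/-- Link `j` is successful if its receiver decodes its own sender. -/
def Successful (L : LinkSet n) (α β noise : ℝ) (a : Profile n Pmax) (j : Fin n) : Prop :=
  Decodes L α β noise a j j

open Classical in
/-- The number of successful links in a profile. -/
def numSuccessful (L : LinkSet n) (α β noise : ℝ) (a : Profile n Pmax) : ℕ :=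
  (Finset.univ.filter fun j => Successful L α β noise a j).card

/-- The capacity: the maximum number of simultaneously successful links. -/
def opt (L : LinkSet n) (α β noise : ℝ) (Pmax : ℕ) : ℕ :=
  Finset.univ.sup fun a : Profile n Pmax => numSuccessful L α β noise a

open Classical in
/-- The utility of link `i`: `0` if it does not transmit, `1` if it is successful, and `-1` if it
transmits unsuccessfully. -/
def utility (L : LinkSet n) (α β noise : ℝ) (a : Profile n Pmax) (i : Fin n) : ℝ :=
  if a i = 0 then 0 else if Successful L α β noise a i then 1 else -1

/-- The regret of link `i` in a history `H` of `T` rounds: its average utility under the best fixed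
strategy in hindsight minus its actual average utility. -/
def regret (L : LinkSet n) (α β noise : ℝ) {T : ℕ} (H : Fin T → Profile n Pmax) (i : Fin n) : ℝ :=
  (⨆ s : Fin (Pmax + 1), (1 / (T : ℝ)) *
      ∑ t, utility L α β noise (Function.update (H t) i s) i)
    - (1 / (T : ℝ)) * ∑ t, utility L α β noise (H t) i

/-- An `ε`-regret history: it has at least one round and every link has regret at most `ε`. -/
def IsRegretHistory (L : LinkSet n) (α β noise ε : ℝ) {T : ℕ} (H : Fin T → Profile n Pmax) : Prop :=
  0 < T ∧ ∀ i, regret L α β noise H i ≤ ε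

/-- The value of a history: the number of successful links, averaged over time. -/
def value (L : LinkSet n) (α β noise : ℝ) {T : ℕ} (H : Fin T → Profile n Pmax) : ℝ≥0∞ :=
  (∑ t, (numSuccessful L α β noise (H t) : ℝ≥0∞)) / (T : ℝ≥0∞)

/-- The value of the worst `ε`-regret history. -/
def worstRegretValue (L : LinkSet n) (α β noise : ℝ) (Pmax : ℕ) (ε : ℝ) : ℝ≥0∞ :=
  ⨅ (T : ℕ) (H : Fin T → Profile n Pmax) (_ : IsRegretHistory L α β noise ε H),
    value L α β noise H

/-- The price of total anarchy with power control and interference cancellation: the ratio of the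
capacity to the value of the worst `ε`-regret history. It is `∞` if some history
has value `0` although the capacity is positive. -/
def priceOfTotalAnarchy (L : LinkSet n) (α β noise : ℝ) (Pmax : ℕ) (ε : ℝ) : ℝ≥0∞ :=
  (opt L α β noise Pmax : ℝ≥0∞) / worstRegretValue L α β noise Pmax ε

end Wireless

end

/-!
# The price of total anarchy with power control and interference cancellation

Write `D_i` for the length of link `i`, `R_i` for the strength of its own signal, and `w k i` for
the affectance of link `i` by sender `k` at full power, which is, up to constants, the smaller of
`1` and the ratio of the interference to what `i` tolerates at full power.

*Upper bound.* In a low-regret history no link gains by always using full power. If it did and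
failed in some round, then the transmitting senders would affect it by at least `1 / 2` in that
round (`one_sub_le_utility`). Summed over a set of links which no sender affects by more than `Λ`
in total, this shows that the average number of transmissions is at least proportional to the size
of the set divided by `1 + Λ`; moreover, since silence is hardly a gain either, a fixed fraction of
the transmissions succeeds (`card_mul_le_sum_success`). So it suffices to find such a set, with
`Λ = O(1 + log (Δ * Pmax))`, that contains a quarter of the links of an optimal solution
(`exists_subset_sum_affectance_le`).

The only property of cancellation needed for this is `CancellationBounded`: at the receiver of a
successful link, all signals of strength at most `b` add up to at most `2 * b`, for every `b` not
below the own signal. Indeed, if the strongest of them beats the own signal, it is decoded in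
spite of the others, and otherwise the own signal is (`Successful.sum_le`). Now fix a sender at
`z`, let `f_i` be the distance from `z` to the receiver of `i`, and suppose first that noise plays
no role, so that `w` is about `min 1 ((D_i / f_i) ^ α)`. Links with the same `R_i`, up to a factor
`2`, contribute a bounded amount if `f_i` is much smaller (`card_le_of_near`) or much larger than
`D_i` (`sum_le_of_far`), and so do links with the same power if `f_i` is comparable to `D_i`
(`card_le_of_intermediate`). There are only `O(1 + log (Δ * Pmax))` dyadic scales for `R_i` and
for the powers, whence `sum_le_log`. Links that can hardly overcome the noise tolerate arbitrarily
little interference, but they all use at least half of the full power and have comparable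
lengths, and an averaging argument deals with them (`exists_subset_sum_blocking_le`).

*Lower bound.* At a common receiver a number of signals proportional to `log (Δ * Pmax)`, whose
strengths form a geometric progression, can all be decoded, but two equally strong signals block
everything weaker. If `Δ` is at least `Pmax` and large, the progression comes from the lengths,
and the blocking links have receivers elsewhere and always succeed (`exists_linkSet_lengths`). If
`Pmax` is at least `Δ` and large, it comes from the powers, and three pairs of links take turns at
blocking and make up for it by a common success (`exists_linkSet_powers`). In both cases a history
without regret has bounded value.
-/

namespace Wireless

/-! ### Packing bounds for families of links with cancellation -/

section Geometry

variable {ι X : Type*} [PseudoMetricSpace X] {s r : ι → X} {P : ι → ℝ} {α : ℝ} {O S : Finset ι}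

/-- The strength with which the signal of sender `i`, transmitting with real power `P i`, arrives at
receiver `j`. -/
noncomputable def strength (s r : ι → X) (P : ι → ℝ) (α : ℝ) (i j : ι) : ℝ :=
  P i / dist (s i) (r j) ^ α

/-- The only consequence of decodability that the packing arguments use: at every receiver `j` of
the family, the signals of strength at most `b` sum up to at most `2 * b`, as soon as `b` is at
least the strength of the own signal of `j`. -/
structure CancellationBounded (s r : ι → X) (P : ι → ℝ) (α : ℝ) (O : Finset ι) : Prop where
  power_pos : ∀ i ∈ O, 0 < P i
  dist_pos : ∀ i ∈ O, ∀ j ∈ O, 0 < dist (s i) (r j)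
  sum_le : ∀ j ∈ O, ∀ b, strength s r P α j j ≤ b →
    ∑ i ∈ O with strength s r P α i j ≤ b, strength s r P α i j ≤ 2 * b

namespace CancellationBounded

lemma strength_pos (h : CancellationBounded s r P α O) {i j : ι} (hi : i ∈ O) (hj : j ∈ O) :
    0 < strength s r P α i j :=
  div_pos (h.power_pos i hi) (Real.rpow_pos_of_pos (h.dist_pos i hi j hj) _)

lemma sum_le_of_subset (h : CancellationBounded s r P α O) (hS : S ⊆ O) {j : ι} (hj : j ∈ O)
    {b : ℝ} (hb : strength s r P α j j ≤ b) (hSb : ∀ i ∈ S, strength s r P α i j ≤ b) :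
    ∑ i ∈ S, strength s r P α i j ≤ 2 * b := by
  refine le_trans (Finset.sum_le_sum_of_subset_of_nonneg ?_ ?_) (h.sum_le j hj b hb)
  · intro i hi
    exact Finset.mem_filter.2 ⟨hS hi, hSb i hi⟩
  · intro i hi _
    exact (h.strength_pos (Finset.mem_filter.1 hi).1 hj).le

lemma card_mul_le (h : CancellationBounded s r P α O) (hS : S ⊆ O) {j : ι} (hj : j ∈ O)
    {a b : ℝ} (hb : strength s r P α j j ≤ b) (hSa : ∀ i ∈ S, a ≤ strength s r P α i j)
    (hSb : ∀ i ∈ S, strength s r P α i j ≤ b) :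
    S.card * a ≤ 2 * b := by
  have := Finset.card_nsmul_le_sum S _ a hSa
  rw [nsmul_eq_mul] at this
  exact this.trans (h.sum_le_of_subset hS hj hb hSb)

/-- The counting bound in the form in which it is applied: comparable powers, and distances to the
receiver `j` that are comparable to `D`. -/
lemma card_le_of_dist (h : CancellationBounded s r P α O) (hα : 0 < α) (hS : S ⊆ O) {j : ι}
    (hj : j ∈ O) {p l D u v : ℝ} (hp : 0 < p) (hD : 0 < D) (hu : 0 < u) (hv : 0 < v)
    (hP : ∀ i ∈ S, p ≤ P i ∧ P i ≤ l * p)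
    (hd : ∀ i ∈ S, D / u ≤ dist (s i) (r j) ∧ dist (s i) (r j) ≤ v * D)
    (hPj : P j ≤ l * p) (hdj : D / u ≤ dist (s j) (r j)) :
    (S.card : ℝ) ≤ 2 * l * (u * v) ^ α := by
  have hlp : 0 < l * p := (h.power_pos j hj).trans_le hPj
  have hDu : 0 < D / u := div_pos hD hu
  have key := h.card_mul_le hS hj (a := p / (v * D) ^ α) (b := l * p / (D / u) ^ α)
    (by unfold strength; gcongr)
    (fun i hi => by
      have := hd i hi
      have h0 := h.dist_pos i (hS hi) j hj
      have := hP i hi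
      have hPi := (h.power_pos i (hS hi)).le
      unfold strength
      gcongr
      · exact this.1
      · exact (hd i hi).2)
    (fun i hi => by
      have := hd i hi
      have h0 := h.dist_pos i (hS hi) j hj
      have h1 := hP i hi
      unfold strength
      gcongr
      · exact h1.2
      · exact this.1)
  have hvD : 0 < (v * D) ^ α := Real.rpow_pos_of_pos (by positivity) _
  have hDua : 0 < (D / u) ^ α := Real.rpow_pos_of_pos hDu _
  have e : (u * v) ^ α * (D / u) ^ α = (v * D) ^ α := by
    rw [← Real.mul_rpow (by positivity) (by positivity)]
    congr 1
    field_simp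
  rw [← e] at key hvD
  rw [mul_div_assoc', mul_div_assoc', div_le_div_iff₀ hvD hDua] at key
  have : (S.card : ℝ) * (p * (D / u) ^ α) ≤ (2 * l * (u * v) ^ α) * (p * (D / u) ^ α) := by
    linarith
  exact le_of_mul_le_mul_right this (by positivity)

/-- Boundedly many links of comparable power and length fit into a region whose size is comparable
to that length. All but boundedly many of their signals would have to be cancelled at each
receiver, so that these senders are very close to it; three links with senders this close to each
other's receivers contradict the triangle inequality. -/
lemma card_le_of_cell (h : CancellationBounded s r P α O) (hα : 0 < α) (hS : S ⊆ O)
    {p l D M : ℝ} (hp : 0 < p) (hl : 0 ≤ l) (hD : 0 < D) (hM : 0 < M)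
    (hP : ∀ i ∈ S, p ≤ P i ∧ P i ≤ l * p) (hDi : ∀ i ∈ S, D ≤ dist (s i) (r i))
    (hd : ∀ i ∈ S, ∀ j ∈ S, dist (s i) (r j) ≤ M * D) :
    (S.card : ℝ) ≤ 4 * l * (3 * M) ^ α := by
  classical
  by_contra! hlt
  -- The senders that are not very close to receiver `j`; there are boundedly many of them.
  let N : ι → Finset ι := fun j => S.filter fun i => D / 3 ≤ dist (s i) (r j)
  have hN : ∀ j ∈ S, ((N j).card : ℝ) ≤ 2 * l * (3 * M) ^ α := fun j hj =>
    h.card_le_of_dist hα ((Finset.filter_subset _ _).trans hS) (hS hj) hp hD (by norm_num) hM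
      (fun i hi => hP i (Finset.mem_filter.1 hi).1)
      (fun i hi => ⟨(Finset.mem_filter.1 hi).2, hd i (Finset.mem_filter.1 hi).1 j hj⟩)
      (hP j hj).2 (by linarith [hDi j hj])
  have hne : S.Nonempty := by
    by_contra hS0
    rw [Finset.not_nonempty_iff_eq_empty.1 hS0] at hlt
    have : 0 ≤ 4 * l * (3 * M) ^ α := by positivity
    rw [Finset.card_empty, Nat.cast_zero] at hlt
    linarith
  obtain ⟨a, ha⟩ := hne
  have hNN : ∀ x ∈ S, ∃ y ∈ S, dist (s y) (r a) < D / 3 ∧ dist (s y) (r x) < D / 3 := by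
    intro x hx
    have : ((N a ∪ N x).card : ℝ) < S.card := by
      have h1 : ((N a ∪ N x).card : ℝ) ≤ (N a).card + (N x).card := by
        exact_mod_cast Finset.card_union_le _ _
      linarith [hN a ha, hN x hx]
    obtain ⟨y, hy, hy'⟩ := Finset.exists_mem_notMem_of_card_lt_card (by exact_mod_cast this)
    simp only [N, Finset.mem_union, Finset.mem_filter, not_or, not_and, not_le] at hy'
    exact ⟨y, hy, hy'.1 hy, hy'.2 hy⟩
  -- Senders `x` and `y` are close to receiver `a`, and `y` is close to receiver `x`: so the link `x`
  -- is shorter than `D`.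
  obtain ⟨x, hx, hxa, -⟩ := hNN a ha
  obtain ⟨y, hy, hya, hyx⟩ := hNN x hx
  have h1 := hDi x hx
  have h2 := dist_triangle4 (s x) (r a) (s y) (r x)
  rw [dist_comm (r a) (s y)] at h2
  linarith

end CancellationBounded
end Geometry

/-! ### Dyadic scales and the affectance by one point -/

section Dyadic

variable {ι : Type*} {S : Finset ι} {g w : ι → ℝ} {C : ℝ}

/-- If the weights of the indices at which `g` is constant up to a factor `2` sum up to at most `C`,
then the total weight is at most `C` times the number of dyadic scales that `g` meets. -/
lemma sum_le_of_dyadic {A B : ℝ} (hC : 0 ≤ C) (hA : 0 < A) (hAB : A ≤ B)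
    (hg : ∀ i ∈ S, A ≤ g i ∧ g i ≤ B)
    (hw : ∀ S' ⊆ S, ∀ x, 0 < x → (∀ i ∈ S', x ≤ g i ∧ g i ≤ 2 * x) → ∑ i ∈ S', w i ≤ C) :
    ∑ i ∈ S, w i ≤ C * (1 + Real.log (B / A) / Real.log 2) := by
  classical
  have hl2 : 0 < Real.log 2 := Real.log_pos one_lt_two
  have hex : ∀ i, ∃ a : ℕ, i ∈ S → 2 ^ a ≤ g i / A ∧ g i / A < 2 ^ (a + 1) := by
    intro i
    by_cases hi : i ∈ S
    · obtain ⟨a, ha⟩ := exists_nat_pow_near (x := g i / A) (y := 2)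
        ((one_le_div hA).2 (hg i hi).1) one_lt_two
      exact ⟨a, fun _ => ha⟩
    · exact ⟨0, fun h => absurd h hi⟩
  choose a ha using hex
  set N := ⌊Real.log (B / A) / Real.log 2⌋₊
  have hmaps : ∀ i ∈ S, a i ∈ Finset.range (N + 1) := by
    intro i hi
    rw [Finset.mem_range, Nat.lt_succ_iff]
    apply Nat.le_floor
    rw [le_div_iff₀ hl2, ← Real.log_pow]
    refine Real.log_le_log (by positivity) ((ha i hi).1.trans ?_)
    gcongr
    exact (hg i hi).2
  rw [← Finset.sum_fiberwise_of_maps_to hmaps]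
  calc ∑ k ∈ Finset.range (N + 1), ∑ i ∈ S with a i = k, w i
      ≤ ∑ k ∈ Finset.range (N + 1), C := by
        refine Finset.sum_le_sum fun k _ => hw _ (Finset.filter_subset _ _) (2 ^ k * A)
          (by positivity) fun i hi => ?_
        obtain ⟨hiS, rfl⟩ := Finset.mem_filter.1 hi
        have := ha i hiS
        rw [le_div_iff₀ hA, div_lt_iff₀ hA, pow_succ] at this
        exact ⟨this.1, by linarith⟩
    _ = C * (1 + N) := by
        rw [Finset.sum_const, Finset.card_range, nsmul_eq_mul]
        push_cast
        ring
    _ ≤ C * (1 + Real.log (B / A) / Real.log 2) := by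
        gcongr
        exact Nat.floor_le (div_nonneg (Real.log_nonneg ((one_le_div hA).2 hAB)) hl2.le)

/-- If boundedly many indices belong to each dyadic scale, then the sum of the powers is dominated
by a geometric series. -/
lemma sum_rpow_le_of_dyadic {α Y : ℝ} (hα : 0 < α) (hC : 0 ≤ C) (hY : 0 < Y)
    (hg : ∀ i ∈ S, 0 < g i ∧ g i ≤ Y)
    (hcard : ∀ S' ⊆ S, ∀ x, 0 < x → (∀ i ∈ S', x ≤ g i ∧ g i ≤ 2 * x) → (S'.card : ℝ) ≤ C) :
    ∑ i ∈ S, (g i / Y) ^ α ≤ C / (1 - (1 / 2) ^ α) := by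
  classical
  have hex : ∀ i, ∃ a : ℕ, i ∈ S → 2 ^ a ≤ Y / g i ∧ Y / g i < 2 ^ (a + 1) := by
    intro i
    by_cases hi : i ∈ S
    · obtain ⟨a, ha⟩ := exists_nat_pow_near (x := Y / g i) (y := 2)
        ((one_le_div (hg i hi).1).2 (hg i hi).2) one_lt_two
      exact ⟨a, fun _ => ha⟩
    · exact ⟨0, fun h => absurd h hi⟩
  choose a ha using hex
  have hq0 : (0 : ℝ) ≤ (1 / 2 : ℝ) ^ α := by positivity
  have hq1 : (1 / 2 : ℝ) ^ α < 1 := Real.rpow_lt_one (by norm_num) (by norm_num) hα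
  rw [← Finset.sum_fiberwise_of_maps_to (t := S.image a) fun i hi => Finset.mem_image_of_mem a hi]
  calc ∑ k ∈ S.image a, ∑ i ∈ S with a i = k, (g i / Y) ^ α
      ≤ ∑ k ∈ S.image a, C * ((1 / 2) ^ α) ^ k := by
        refine Finset.sum_le_sum fun k _ => ?_
        have hterm : ∀ i ∈ S.filter (fun i => a i = k), (g i / Y) ^ α ≤ ((1 / 2 : ℝ) ^ α) ^ k := by
          intro i hi
          obtain ⟨hiS, rfl⟩ := Finset.mem_filter.1 hi
          have hgi := (hg i hiS).1
          rw [← Real.rpow_natCast, ← Real.rpow_mul (by norm_num), mul_comm α,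
            Real.rpow_mul (by norm_num), Real.rpow_natCast]
          refine Real.rpow_le_rpow (by positivity) ?_ hα.le
          have := (ha i hiS).1
          rw [le_div_iff₀ hgi] at this
          rw [div_le_iff₀ hY, one_div, inv_pow, inv_mul_eq_div, le_div_iff₀ (by positivity)]
          linarith
        refine (Finset.sum_le_card_nsmul _ _ _ hterm).trans ?_
        rw [nsmul_eq_mul]
        gcongr
        refine hcard _ (Finset.filter_subset _ _) (Y / 2 ^ (k + 1)) (by positivity) fun i hi => ?_
        obtain ⟨hiS, rfl⟩ := Finset.mem_filter.1 hi
        have hgi := (hg i hiS).1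
        have := ha i hiS
        rw [le_div_iff₀ hgi, div_lt_iff₀ hgi] at this
        constructor
        · rw [div_le_iff₀ (by positivity)]
          linarith [this.2]
        · rw [pow_succ, mul_div_assoc', le_div_iff₀ (by positivity)]
          linarith [this.1]
    _ = C * ∑ k ∈ S.image a, ((1 / 2) ^ α) ^ k := by rw [Finset.mul_sum]
    _ ≤ C * (1 - (1 / 2) ^ α)⁻¹ := by
        gcongr
        rw [← tsum_geometric_of_lt_one hq0 hq1]
        exact (summable_geometric_of_lt_one hq0 hq1).sum_le_tsum _ fun _ _ => by positivity
    _ = C / (1 - (1 / 2) ^ α) := (div_eq_mul_inv _ _).symm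

end Dyadic

lemma div_rpow_le_mul_div_rpow {p x y u α : ℝ} (hα : 0 ≤ α) (hp : 0 ≤ p) (hx : 0 < x) (hy : 0 < y)
    (hu : 0 < u) (h : x ≤ u * y) : p / y ^ α ≤ u ^ α * (p / x ^ α) := by
  have hxa := Real.rpow_pos_of_pos hx α
  have hya := Real.rpow_pos_of_pos hy α
  have : x ^ α ≤ u ^ α * y ^ α := by
    rw [← Real.mul_rpow hu.le hy.le]
    exact Real.rpow_le_rpow hx.le h hα
  rw [mul_div_assoc', div_le_div_iff₀ hya hxa]
  nlinarith [mul_le_mul_of_nonneg_left this hp]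

section Geometry

variable {ι X : Type*} [PseudoMetricSpace X] {s r : ι → X} {P : ι → ℝ} {α : ℝ} {O S : Finset ι}

namespace CancellationBounded

/-- Links whose receivers are much closer to `z` than their own senders are: the shortest of them
receives each of the others about as strongly as the receiver for which the signal is meant. -/
lemma card_le_of_near (h : CancellationBounded s r P α O) (hα : 0 < α) (hS : S ⊆ O) {z : X} {R : ℝ}
    (hR : 0 < R) (hSR : ∀ i ∈ S, R ≤ strength s r P α i i ∧ strength s r P α i i ≤ 2 * R)
    (hz : ∀ i ∈ S, dist z (r i) ≤ dist (s i) (r i) / 4) :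
    (S.card : ℝ) ≤ 4 * 3 ^ α := by
  rcases S.eq_empty_or_nonempty with rfl | hne
  · rw [Finset.card_empty, Nat.cast_zero]
    positivity
  obtain ⟨j, hj, hmin⟩ := S.exists_min_image (fun i => dist (s i) (r i)) hne
  have hd : ∀ i ∈ S, dist (s i) (r i) ≤ 2 * dist (s i) (r j) ∧
      dist (s i) (r j) ≤ 3 / 2 * dist (s i) (r i) := by
    intro i hi
    have h1 := hmin i hi
    have h2 := hz i hi
    have h3 := hz j hj
    have h4 := dist_triangle4 (s i) (r j) z (r i)
    have h5 := dist_triangle4 (s i) (r i) z (r j)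
    rw [dist_comm _ z] at h4 h5
    constructor <;> linarith
  have h32 : (0 : ℝ) < (3 / 2) ^ α := by positivity
  have key := h.card_mul_le hS (hS hj) (a := R / (3 / 2) ^ α) (b := 2 ^ α * (2 * R))
    (by
      have : (1 : ℝ) ≤ 2 ^ α := Real.one_le_rpow (by norm_num) hα.le
      nlinarith [(hSR j hj).2])
    (fun i hi => by
      rw [div_le_iff₀ h32, mul_comm]
      exact (hSR i hi).1.trans (div_rpow_le_mul_div_rpow hα.le (h.power_pos i (hS hi)).le
        (h.dist_pos i (hS hi) j (hS hj)) (h.dist_pos i (hS hi) i (hS hi)) (by norm_num)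
        (hd i hi).2))
    (fun i hi => (div_rpow_le_mul_div_rpow hα.le (h.power_pos i (hS hi)).le
        (h.dist_pos i (hS hi) i (hS hi)) (h.dist_pos i (hS hi) j (hS hj)) (by norm_num)
        (hd i hi).1).trans (by gcongr; exact (hSR i hi).2))
  have e : (3 : ℝ) ^ α = (3 / 2) ^ α * 2 ^ α := by
    rw [← Real.mul_rpow (by norm_num) (by norm_num)]
    norm_num
  rw [e]
  rw [mul_div_assoc', div_le_iff₀ h32] at key
  exact le_of_mul_le_mul_right (by linarith) hR

/-- Links whose receivers are about as far from `z` as from their own senders: the longest of them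
receives all signals from much shorter ones at a strength determined by their powers, and the
remaining ones form a cell. -/
lemma card_le_of_intermediate (h : CancellationBounded s r P α O) (hα : 0 < α) (hS : S ⊆ O) {z : X}
    {p : ℝ} (hp : 0 < p) (hP : ∀ i ∈ S, p ≤ P i ∧ P i ≤ 2 * p)
    (hz : ∀ i ∈ S, dist (s i) (r i) / 4 ≤ dist z (r i) ∧ dist z (r i) ≤ 4 * dist (s i) (r i)) :
    (S.card : ℝ) ≤ 4 * 40 ^ α + 8 * 1080 ^ α := by
  classical
  rcases S.eq_empty_or_nonempty with rfl | hne
  · rw [Finset.card_empty, Nat.cast_zero]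
    positivity
  obtain ⟨j, hj, hmax⟩ := S.exists_max_image (fun i => dist (s i) (r i)) hne
  have hDj := h.dist_pos j (hS hj) j (hS hj)
  have hsz : ∀ i ∈ S, dist (s i) z ≤ 5 * dist (s i) (r i) := by
    intro i hi
    have := dist_triangle (s i) (r i) z
    rw [dist_comm (r i)] at this
    linarith [(hz i hi).2]
  have hfj := hz j hj
  rw [← Finset.card_filter_add_card_filter_not
    (p := fun i => dist (s i) (r i) ≤ dist (s j) (r j) / 40)]
  push_cast
  refine add_le_add ?_ ?_
  · have := h.card_le_of_dist hα
      ((Finset.filter_subset (fun i => dist (s i) (r i) ≤ dist (s j) (r j) / 40) S).trans hS)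
      (hS hj) (p := p) (l := 2) (D := dist (s j) (r j)) (u := 8) (v := 5) hp hDj (by norm_num)
      (by norm_num) (fun i hi => hP i (Finset.mem_filter.1 hi).1) (fun i hi => ?_) (hP j hj).2
      (by linarith)
    · norm_num at this ⊢
      exact this
    · obtain ⟨hi, hij⟩ := Finset.mem_filter.1 hi
      have h1 := hsz i hi
      have h2 := dist_triangle (s i) z (r j)
      have h3 := dist_triangle z (s i) (r j)
      rw [dist_comm z (s i)] at h3
      constructor <;> linarith
  · have := h.card_le_of_cell hα
      ((Finset.filter_subset (fun i => ¬ dist (s i) (r i) ≤ dist (s j) (r j) / 40) S).trans hS)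
      (p := p) (l := 2) (D := dist (s j) (r j) / 40) (M := 360) hp (by norm_num) (by positivity)
      (by norm_num) (fun i hi => hP i (Finset.mem_filter.1 hi).1)
      (fun i hi => (not_le.1 (Finset.mem_filter.1 hi).2).le) (fun i hi k hk => ?_)
    · norm_num at this ⊢
      exact this
    · have hi := (Finset.mem_filter.1 hi).1
      have hk := (Finset.mem_filter.1 hk).1
      have h1 := hsz i hi
      have h2 := dist_triangle (s i) z (r k)
      linarith [(hz k hk).2, hmax i hi, hmax k hk]

/-- Links that are much shorter than the distance of their receivers to `z`. Consider the receiver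
closest to `z`. A sender at distance at least its own link length from it contributes to the
interference there about as much as to the sum in question. The other links cluster around this
receiver, so that each length scale contains boundedly many of them. -/
lemma sum_le_of_far (h : CancellationBounded s r P α O) (hα : 0 < α) (hS : S ⊆ O) {z : X} {R : ℝ}
    (hR : 0 < R) (hSR : ∀ i ∈ S, R ≤ strength s r P α i i ∧ strength s r P α i i ≤ 2 * R)
    (hz : ∀ i ∈ S, 4 * dist (s i) (r i) ≤ dist z (r i)) :
    ∑ i ∈ S, (dist (s i) (r i) / dist z (r i)) ^ α
      ≤ 4 * (9 / 4) ^ α + 8 * 36 ^ α / (1 - (1 / 2) ^ α) := by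
  classical
  have hq1 : (1 / 2 : ℝ) ^ α < 1 := Real.rpow_lt_one (by norm_num) (by norm_num) hα
  have hq : 0 < 1 - (1 / 2 : ℝ) ^ α := by linarith
  rcases S.eq_empty_or_nonempty with rfl | hne
  · rw [Finset.sum_empty]
    positivity
  obtain ⟨j, hj, hmin⟩ := S.exists_min_image (fun i => dist z (r i)) hne
  have hD : ∀ i ∈ S, 0 < dist (s i) (r i) := fun i hi => h.dist_pos i (hS hi) i (hS hi)
  rw [← Finset.sum_filter_add_sum_filter_not S (fun i => dist (s i) (r i) ≤ dist (s i) (r j))]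
  refine add_le_add ?_ ?_
  · -- The signals from these senders arrive at `j` no stronger than `2 * R`, so that they are
    -- controlled by the interference bound there.
    set A := S.filter fun i => dist (s i) (r i) ≤ dist (s i) (r j)
    have hA : A ⊆ S := Finset.filter_subset _ _
    have hsum := h.sum_le_of_subset (hA.trans hS) (hS hj) (hSR j hj).2 (fun i hi => by
      have := div_rpow_le_mul_div_rpow hα.le (h.power_pos i (hS (hA hi))).le (hD i (hA hi))
        (h.dist_pos i (hS (hA hi)) j (hS hj)) one_pos
        (by rw [one_mul]; exact (Finset.mem_filter.1 hi).2)
      rw [Real.one_rpow, one_mul] at this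
      exact this.trans (hSR i (hA hi)).2)
    have hterm : ∀ i ∈ A, R * (dist (s i) (r i) / dist z (r i)) ^ α
        ≤ (9 / 4) ^ α * strength s r P α i j := by
      intro i hi
      have hi := hA hi
      have h4 := hz i hi
      have hDi := hD i hi
      have hz0 : 0 < dist z (r i) := by linarith
      have hd : dist (s i) (r j) ≤ 9 / 4 * dist z (r i) := by
        have h1 := dist_triangle4 (s i) (r i) z (r j)
        rw [dist_comm (r i)] at h1
        linarith [hmin i hi]
      refine le_trans ?_ (div_rpow_le_mul_div_rpow hα.le (h.power_pos i (hS hi)).le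
        (h.dist_pos i (hS hi) j (hS hj)) hz0 (by norm_num) hd)
      rw [Real.div_rpow hDi.le hz0.le, mul_div_assoc']
      gcongr
      have := (hSR i hi).1
      rwa [strength, le_div_iff₀ (Real.rpow_pos_of_pos hDi _)] at this
    have := Finset.sum_le_sum hterm
    rw [← Finset.mul_sum, ← Finset.mul_sum] at this
    have h94 : (0 : ℝ) < (9 / 4) ^ α := by positivity
    refine le_of_mul_le_mul_left (this.trans ?_) hR
    nlinarith
  · -- These senders and receivers lie within two link lengths of `r j`.
    set B := S.filter fun i => ¬ dist (s i) (r i) ≤ dist (s i) (r j)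
    have hB : B ⊆ S := Finset.filter_subset _ _
    have hBd : ∀ i ∈ B, dist (s i) (r j) < dist (s i) (r i) := fun i hi =>
      not_le.1 (Finset.mem_filter.1 hi).2
    have hzj : 0 < dist z (r j) := by linarith [hz j hj, hD j hj]
    have hrr : ∀ i ∈ B, dist (r j) (r i) ≤ 2 * dist (s i) (r i) := by
      intro i hi
      have := dist_triangle (r j) (s i) (r i)
      rw [dist_comm (r j) (s i)] at this
      linarith [hBd i hi]
    refine le_trans (Finset.sum_le_sum fun i hi => ?_)
      (sum_rpow_le_of_dyadic (g := fun i => dist (s i) (r i)) (Y := dist z (r j)) (C := 8 * 36 ^ α)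
        hα (by positivity) hzj (fun i hi => ⟨hD i (hB hi), ?_⟩) ?_)
    · have := hmin i (hB hi)
      gcongr
    · have := dist_triangle z (r j) (r i)
      linarith [hrr i hi, hz i (hB hi), hD i (hB hi)]
    · intro S' hS' x hx hxS
      have hS'S := hS'.trans hB
      have := h.card_le_of_cell hα (hS'S.trans hS) (p := R * x ^ α) (l := 2 * 2 ^ α)
        (D := x) (M := 6)
        (by positivity) (by positivity) hx (by norm_num) (fun i hi => ?_) (fun i hi => (hxS i hi).1)
        (fun i hi k hk => ?_)
      · have e : (36 : ℝ) ^ α = 2 ^ α * (3 * 6) ^ α := by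
          rw [← Real.mul_rpow (by norm_num) (by norm_num)]
          norm_num
        rw [e]
        linarith
      · have hDi := hD i (hS'S hi)
        have hDa := Real.rpow_pos_of_pos hDi α
        have h1 := hSR i (hS'S hi)
        rw [strength, le_div_iff₀ hDa, div_le_iff₀ hDa] at h1
        have h2 : x ^ α ≤ dist (s i) (r i) ^ α := Real.rpow_le_rpow hx.le (hxS i hi).1 hα.le
        have h3 : dist (s i) (r i) ^ α ≤ 2 ^ α * x ^ α := by
          rw [← Real.mul_rpow (by norm_num) hx.le]
          exact Real.rpow_le_rpow hDi.le (hxS i hi).2 hα.le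
        constructor
        · nlinarith
        · nlinarith
      · have h1 := dist_triangle (s i) (r j) (r k)
        linarith [hBd i (hS' hi), hrr k (hS' hk), (hxS i hi).2, (hxS k hk).2]

end CancellationBounded
end Geometry

/-! ### Blocking weights and the total affectance by one point -/

/-- The weight of an interference `x` against a tolerance `t`. It agrees with `min 1 (x / t)` up
to a factor `2`, and equals `1` if the tolerance is `0` and there is some interference. -/
noncomputable def blocking (t x : ℝ) : ℝ := x / (x + t)

section Blocking

variable {ι : Type*} {S : Finset ι} {t x y : ℝ}

lemma blocking_nonneg (ht : 0 ≤ t) (hx : 0 ≤ x) : 0 ≤ blocking t x :=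
  div_nonneg hx (add_nonneg hx ht)

lemma blocking_le_one (ht : 0 ≤ t) (hx : 0 ≤ x) : blocking t x ≤ 1 :=
  div_le_one_of_le₀ (by linarith) (add_nonneg hx ht)

lemma blocking_le_div (ht : 0 < t) (hx : 0 ≤ x) : blocking t x ≤ x / t :=
  div_le_div_of_nonneg_left hx ht (by linarith)

lemma blocking_le_mul {c : ℝ} (ht : 0 ≤ t) (hx : 0 < x) (hy : 0 < y) (hc : 1 ≤ c)
    (h : x ≤ c * y) : blocking t x ≤ c * blocking t y := by
  unfold blocking
  rw [mul_div_assoc', div_le_div_iff₀ (by linarith) (by linarith)]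
  nlinarith [mul_nonneg hx.le hy.le, mul_nonneg (sub_nonneg.2 hc) (mul_nonneg hx.le hy.le),
    mul_le_mul_of_nonneg_right h ht]

lemma sum_blocking_le {c : ℝ} {f : ι → ℝ} (ht : 0 ≤ t) (hc : 0 ≤ c) (hf : ∀ i ∈ S, 0 ≤ f i)
    (h : ∑ i ∈ S, f i ≤ c * t) : ∑ i ∈ S, blocking t (f i) ≤ c := by
  rcases ht.eq_or_lt with rfl | ht
  · rw [mul_zero] at h
    have := (Finset.sum_eq_zero_iff_of_nonneg hf).1 (le_antisymm h (Finset.sum_nonneg hf))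
    rw [Finset.sum_eq_zero fun i hi => by rw [blocking, this i hi, zero_div]]
    exact hc
  · refine (Finset.sum_le_sum fun i hi => blocking_le_div ht (hf i hi)).trans ?_
    rw [← Finset.sum_div]
    exact (div_le_iff₀ ht).2 h

lemma half_le_sum_blocking {f : ι → ℝ} (ht : 0 ≤ t) (hf : ∀ i ∈ S, 0 ≤ f i)
    (h : t < ∑ i ∈ S, f i) : 1 / 2 ≤ ∑ i ∈ S, blocking t (f i) := by
  set F := ∑ i ∈ S, f i with hF
  calc (1 : ℝ) / 2 ≤ F / (F + t) := by
        rw [div_le_div_iff₀ two_pos (by linarith)]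
        linarith
    _ = ∑ i ∈ S, f i / (F + t) := by rw [hF, Finset.sum_div]
    _ ≤ ∑ i ∈ S, blocking t (f i) := by
        refine Finset.sum_le_sum fun i hi => ?_
        have h1 := Finset.single_le_sum hf hi
        rcases (hf i hi).eq_or_lt with h0 | h0
        · rw [← h0, zero_div, blocking, zero_div]
        · exact div_le_div_of_nonneg_left h0.le (by linarith) (by linarith)

end Blocking

section Geometry

variable {ι X : Type*} [PseudoMetricSpace X] {s r : ι → X} {P : ι → ℝ} {α : ℝ} {O S : Finset ι}

namespace CancellationBounded

/-- A signal from any point `z` affects only logarithmically many links of the family. The near and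
the far links are counted by the strength of their own signals and the remaining ones by their
powers; each dyadic scale contributes a bounded amount. -/
lemma sum_le_log (h : CancellationBounded s r P α O) (hα : 0 < α) (hS : S ⊆ O) {z : X} {Q Δ K : ℝ}
    (hQ : 1 ≤ Q) (hΔ : 1 ≤ Δ) (hK : 0 ≤ K) (hP : ∀ i ∈ S, 1 ≤ P i ∧ P i ≤ Q)
    (hD : ∀ i ∈ S, 1 ≤ dist (s i) (r i) ∧ dist (s i) (r i) ≤ Δ) {w : ι → ℝ}
    (hw1 : ∀ i ∈ S, w i ≤ 1)
    (hw : ∀ i ∈ S, w i ≤ K * (dist (s i) (r i) / dist z (r i)) ^ α) :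
    ∑ i ∈ S, w i ≤ (4 * 3 ^ α + K * (4 * (9 / 4) ^ α + 8 * 36 ^ α / (1 - (1 / 2) ^ α))
      + (4 * 40 ^ α + 8 * 1080 ^ α)) * (1 + (1 + α) / Real.log 2 * Real.log (Δ * Q)) := by
  classical
  have hl2 : 0 < Real.log 2 := Real.log_pos one_lt_two
  have hQ0 : 0 < Q := by linarith
  have hΔ0 : 0 < Δ := by linarith
  have hlQ := Real.log_nonneg hQ
  have hlΔ := Real.log_nonneg hΔ
  have hq1 : (1 / 2 : ℝ) ^ α < 1 := Real.rpow_lt_one (by norm_num) (by norm_num) hα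
  have hq : 0 < 1 - (1 / 2 : ℝ) ^ α := by linarith
  have hΔa : 1 ≤ Δ ^ α := Real.one_le_rpow hΔ hα.le
  rw [Real.log_mul hΔ0.ne' hQ0.ne']
  have hcard : ∀ S' ⊆ S, ∑ i ∈ S', w i ≤ S'.card := fun S' hS' => by
    have := Finset.sum_le_card_nsmul S' w 1 fun i hi => hw1 i (hS' hi)
    simpa using this
  have hlogR : Real.log (Q / (1 / Δ ^ α)) = Real.log Q + α * Real.log Δ := by
    rw [div_div_eq_mul_div, div_one, Real.log_mul hQ0.ne' (by positivity), Real.log_rpow hΔ0]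
  have hR : ∀ i ∈ S, 1 / Δ ^ α ≤ strength s r P α i i ∧ strength s r P α i i ≤ Q := by
    intro i hi
    have h1 := hD i hi
    have h2 := hP i hi
    have h3 : 1 ≤ dist (s i) (r i) ^ α := Real.one_le_rpow h1.1 hα.le
    unfold strength
    constructor
    · have hPi : 0 ≤ P i := by linarith
      have hDi : 0 < dist (s i) (r i) := by linarith
      gcongr
      · exact h2.1
      · exact h1.2
    · rw [div_le_iff₀ (by linarith)]
      nlinarith
  have hAB : 1 / Δ ^ α ≤ Q := by
    rw [div_le_iff₀ (by linarith)]
    nlinarith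
  set S₁ := S.filter fun i => dist z (r i) ≤ dist (s i) (r i) / 4 with hS₁
  set S' := S.filter fun i => ¬ dist z (r i) ≤ dist (s i) (r i) / 4 with hS'
  set S₂ := S'.filter fun i => 4 * dist (s i) (r i) ≤ dist z (r i) with hS₂
  set S₃ := S'.filter fun i => ¬ 4 * dist (s i) (r i) ≤ dist z (r i) with hS₃
  have e : ∑ i ∈ S, w i = ∑ i ∈ S₁, w i + ∑ i ∈ S₂, w i + ∑ i ∈ S₃, w i := by
    rw [add_assoc, hS₂, hS₃, Finset.sum_filter_add_sum_filter_not, hS₁, hS',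
      Finset.sum_filter_add_sum_filter_not]
  have i₁ : S₁ ⊆ S := Finset.filter_subset _ _
  have i' : S' ⊆ S := Finset.filter_subset _ _
  have i₂ : S₂ ⊆ S := (Finset.filter_subset _ _).trans i'
  have i₃ : S₃ ⊆ S := (Finset.filter_subset _ _).trans i'
  have b₁ := sum_le_of_dyadic (S := S₁) (w := w) (C := 4 * 3 ^ α) (by positivity)
    (by positivity) hAB
    (fun i hi => hR i (i₁ hi)) fun S'' hS'' x hx hxS => (hcard _ (hS''.trans i₁)).trans
      (h.card_le_of_near hα ((hS''.trans i₁).trans hS) hx hxS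
        fun i hi => (Finset.mem_filter.1 (hS'' hi)).2)
  have b₂ := sum_le_of_dyadic (S := S₂) (w := w)
    (C := K * (4 * (9 / 4) ^ α + 8 * 36 ^ α / (1 - (1 / 2) ^ α)))
    (by positivity) (by positivity) hAB
    (fun i hi => hR i (i₂ hi)) fun S'' hS'' x hx hxS => by
      refine (Finset.sum_le_sum fun i hi => hw i (i₂ (hS'' hi))).trans ?_
      rw [← Finset.mul_sum]
      gcongr
      exact h.sum_le_of_far hα ((hS''.trans i₂).trans hS) hx hxS
        fun i hi => (Finset.mem_filter.1 (hS'' hi)).2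
  have b₃ := sum_le_of_dyadic (S := S₃) (w := w) (C := 4 * 40 ^ α + 8 * 1080 ^ α) (by positivity)
    one_pos hQ (fun i hi => hP i (i₃ hi)) fun S'' hS'' x hx hxS =>
      (hcard _ (hS''.trans i₃)).trans
      (h.card_le_of_intermediate hα ((hS''.trans i₃).trans hS) (z := z) hx hxS fun i hi => by
        have h1 := Finset.mem_filter.1 (hS'' hi)
        have h2 := Finset.mem_filter.1 h1.1
        exact ⟨(not_le.1 h2.2).le, (not_le.1 h1.2).le⟩)
  rw [hlogR] at b₁ b₂
  rw [div_one] at b₃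
  have hX : (Real.log Q + α * Real.log Δ) / Real.log 2
      ≤ (1 + α) / Real.log 2 * (Real.log Δ + Real.log Q) := by
    rw [div_mul_eq_mul_div]
    gcongr
    nlinarith
  have hY : Real.log Q / Real.log 2 ≤ (1 + α) / Real.log 2 * (Real.log Δ + Real.log Q) := by
    rw [div_mul_eq_mul_div]
    gcongr
    nlinarith
  rw [e, add_mul, add_mul]
  refine add_le_add (add_le_add (b₁.trans ?_) (b₂.trans ?_)) (b₃.trans ?_) <;> gcongr

/-- For links of comparable power and length, with arbitrary tolerances `t`, half of the senders
affect the family only by a bounded amount, because each receiver is affected by a bounded amount.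
The links of these senders are the ones to keep: the effect of another point `z` on them is
dominated by that of the sender closest to `z`, up to a cell of links. -/
lemma exists_subset_sum_blocking_le (h : CancellationBounded s r P α O) (hα : 0 < α) (hS : S ⊆ O)
    {p D c : ℝ} {t : ι → ℝ} (hp : 0 < p) (hD : 0 < D) (hc : 0 < c) (ht : ∀ i ∈ S, 0 ≤ t i)
    (hP : ∀ i ∈ S, p ≤ P i ∧ P i ≤ 2 * p)
    (hDi : ∀ i ∈ S, D ≤ dist (s i) (r i) ∧ dist (s i) (r i) ≤ 2 ^ (1 / α) * D)
    (hint : ∀ i ∈ S, ∀ A ⊆ S, i ∉ A → (∀ k ∈ A, strength s r P α k i ≤ strength s r P α i i) →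
      c * ∑ k ∈ A, strength s r P α k i ≤ t i) :
    ∃ S' ⊆ S, S.card ≤ 2 * S'.card ∧ ∀ z, (∀ i ∈ S', 0 < dist z (r i)) →
      ∑ i ∈ S', blocking (t i) (c * (2 * p) / dist z (r i) ^ α)
        ≤ 8 * (27 * 2 ^ (1 / α)) ^ α +
          (9 / 4) ^ α * (2 * (8 * (9 * (2 ^ (1 / α)) ^ 2) ^ α + 2)) := by
  classical
  set a : ℝ := 2 ^ (1 / α) with ha
  have ha1 : 1 ≤ a := Real.one_le_rpow (by norm_num) (by positivity)
  have haα : a ^ α = 2 := by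
    rw [ha, ← Real.rpow_mul (by norm_num), one_div_mul_cancel hα.ne', Real.rpow_one]
  set C₁ : ℝ := 8 * (9 * a ^ 2) ^ α + 2 with hC₁
  have hC₁0 : 0 < C₁ := by positivity
  set w : ι → ι → ℝ := fun k i => blocking (t i) (c * (2 * p) / dist (s k) (r i) ^ α) with hw
  have hdpos : ∀ k ∈ S, ∀ i ∈ S, 0 < dist (s k) (r i) :=
    fun k hk i hi => h.dist_pos k (hS hk) i (hS hi)
  have hIpos : ∀ k ∈ S, ∀ i ∈ S, 0 < c * (2 * p) / dist (s k) (r i) ^ α := fun k hk i hi =>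
    div_pos (by positivity) (Real.rpow_pos_of_pos (hdpos k hk i hi) _)
  have hw0 : ∀ k ∈ S, ∀ i ∈ S, 0 ≤ w k i := fun k hk i hi =>
    blocking_nonneg (ht i hi) (hIpos k hk i hi).le
  -- At receiver `i`, the nearby senders form a cell, and the others arrive weaker than the own
  -- signal.
  have hcol : ∀ i ∈ S, ∑ k ∈ S, w k i ≤ C₁ := by
    intro i hi
    rw [← Finset.sum_filter_add_sum_filter_not S (fun k => dist (s k) (r i) ≤ a ^ 2 * D), hC₁]
    refine add_le_add ?_ ?_
    · set A := S.filter fun k => dist (s k) (r i) ≤ a ^ 2 * D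
      have hA : A ⊆ S := Finset.filter_subset _ _
      have h1 : ∑ k ∈ A, w k i ≤ A.card := by
        have := Finset.sum_le_card_nsmul A (fun k => w k i) 1 fun k hk =>
          blocking_le_one (ht i hi) (hIpos k (hA hk) i hi).le
        simpa using this
      have h2 := h.card_le_of_cell hα (hA.trans hS) (l := 2) (M := 3 * a ^ 2) hp (by norm_num) hD
        (by positivity) (fun k hk => hP k (hA hk)) (fun k hk => (hDi k (hA hk)).1)
        (fun k hk l hl => by
          have h3 := dist_triangle4 (s k) (r i) (s l) (r l)
          rw [dist_comm (r i)] at h3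
          have h4 := (Finset.mem_filter.1 hk).2
          have h5 := (Finset.mem_filter.1 hl).2
          have h6 := (hDi l (hA hl)).2
          nlinarith [mul_nonneg (mul_nonneg (by linarith : 0 ≤ a) (sub_nonneg.2 ha1)) hD.le])
      refine h1.trans (h2.trans (le_of_eq ?_))
      ring_nf
    · set A := S.filter fun k => ¬ dist (s k) (r i) ≤ a ^ 2 * D with hAdef
      have hA : A ⊆ S := Finset.filter_subset _ _
      have hda : ∀ k ∈ A, a * dist (s i) (r i) ≤ dist (s k) (r i) := by
        intro k hk
        have h1 := not_le.1 (Finset.mem_filter.1 hk).2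
        nlinarith [(hDi i hi).2]
      have hiA : i ∉ A := by
        intro hiA
        have h1 := not_le.1 (Finset.mem_filter.1 hiA).2
        nlinarith [(hDi i hi).2,
          mul_nonneg (mul_nonneg (by linarith : 0 ≤ a) (sub_nonneg.2 ha1)) hD.le]
      have h1 := hint i hi A hA hiA fun k hk => by
        have hki := hdpos k (hA hk) i hi
        have hii := hdpos i hi i hi
        have h2 : 2 * dist (s i) (r i) ^ α ≤ dist (s k) (r i) ^ α := by
          rw [← haα, ← Real.mul_rpow (by positivity) hii.le]
          exact Real.rpow_le_rpow (by positivity) (hda k hk) hα.le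
        have hii' := Real.rpow_pos_of_pos hii α
        unfold strength
        rw [div_le_div_iff₀ (by linarith) hii']
        nlinarith [(hP k (hA hk)).2, (hP i hi).1]
      refine sum_blocking_le (ht i hi) (by norm_num) (fun k hk => (hIpos k (hA hk) i hi).le) ?_
      refine le_trans ?_ (mul_le_mul_of_nonneg_left h1 zero_le_two)
      rw [Finset.mul_sum, Finset.mul_sum]
      refine Finset.sum_le_sum fun k hk => ?_
      have := Real.rpow_pos_of_pos (hdpos k (hA hk) i hi) α
      have hPk := (hP k (hA hk)).1
      unfold strength
      rw [mul_div_assoc', mul_div_assoc']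
      refine div_le_div_of_nonneg_right ?_ this.le
      nlinarith
  -- Keep the senders whose effect is at most twice the average bound.
  refine ⟨S.filter fun k => ∑ i ∈ S, w k i ≤ 2 * C₁, Finset.filter_subset _ _, ?_, ?_⟩
  · set B := S.filter fun k => ¬ ∑ i ∈ S, w k i ≤ 2 * C₁ with hB
    have hBS : B ⊆ S := Finset.filter_subset _ _
    have h1 : (B.card : ℝ) * (2 * C₁) ≤ S.card * C₁ := by
      calc (B.card : ℝ) * (2 * C₁) ≤ ∑ k ∈ B, ∑ i ∈ S, w k i := by
            rw [← nsmul_eq_mul]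
            exact Finset.card_nsmul_le_sum _ _ _ fun k hk =>
              (not_le.1 (Finset.mem_filter.1 hk).2).le
        _ ≤ ∑ k ∈ S, ∑ i ∈ S, w k i := Finset.sum_le_sum_of_subset_of_nonneg hBS
            fun k hk _ => Finset.sum_nonneg fun i hi => hw0 k hk i hi
        _ = ∑ i ∈ S, ∑ k ∈ S, w k i := Finset.sum_comm
        _ ≤ S.card * C₁ := by
            rw [← nsmul_eq_mul]
            exact Finset.sum_le_card_nsmul _ _ _ hcol
    have h2 : 2 * B.card ≤ S.card := by
      have : (2 * B.card : ℝ) * C₁ ≤ S.card * C₁ := by linarith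
      exact_mod_cast le_of_mul_le_mul_right this hC₁0
    have h3 := Finset.card_filter_add_card_filter_not (s := S)
      (p := fun k => ∑ i ∈ S, w k i ≤ 2 * C₁)
    rw [← hB] at h3
    omega
  · intro z hz
    set S' := S.filter fun k => ∑ i ∈ S, w k i ≤ 2 * C₁ with hS'
    have i' : S' ⊆ S := Finset.filter_subset _ _
    have hJpos : ∀ i ∈ S', 0 < c * (2 * p) / dist z (r i) ^ α := fun i hi =>
      div_pos (by positivity) (Real.rpow_pos_of_pos (hz i hi) _)
    rw [← Finset.sum_filter_add_sum_filter_not S' (fun i => dist z (r i) ≤ 4 * dist (s i) (r i))]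
    refine add_le_add ?_ ?_
    · set A := S'.filter fun i => dist z (r i) ≤ 4 * dist (s i) (r i)
      have hA' : A ⊆ S' := Finset.filter_subset _ _
      have hA := hA'.trans i'
      have h1 : ∑ i ∈ A, blocking (t i) (c * (2 * p) / dist z (r i) ^ α) ≤ A.card := by
        have := Finset.sum_le_card_nsmul A
          (fun i => blocking (t i) (c * (2 * p) / dist z (r i) ^ α)) 1 fun i hi =>
          blocking_le_one (ht i (hA hi)) (hJpos i (hA' hi)).le
        simpa using this
      have h2 := h.card_le_of_cell hα (hA.trans hS) (l := 2) (M := 9 * a) hp (by norm_num) hD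
        (by positivity) (fun k hk => hP k (hA hk)) (fun k hk => (hDi k (hA hk)).1)
        (fun k hk l hl => by
          have h3 := dist_triangle4 (s k) (r k) z (r l)
          rw [dist_comm (r k)] at h3
          have h4 := (Finset.mem_filter.1 hk).2
          have h5 := (Finset.mem_filter.1 hl).2
          have h6 := (hDi l (hA hl)).2
          have h7 := (hDi k (hA hk)).2
          linarith)
      refine h1.trans (h2.trans (le_of_eq ?_))
      ring_nf
    · set A := S'.filter fun i => ¬ dist z (r i) ≤ 4 * dist (s i) (r i)
      have hA' : A ⊆ S' := Finset.filter_subset _ _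
      have hA := hA'.trans i'
      rcases A.eq_empty_or_nonempty with hne | hne
      · rw [hne, Finset.sum_empty]
        positivity
      -- A receiver of `A` is about as far from `z` as its sender, so the sender `j` closest to `z` is
      -- not much farther from these receivers than `z` is.
      obtain ⟨j, hj, hmin⟩ := A.exists_min_image (fun i => dist z (s i)) hne
      calc ∑ i ∈ A, blocking (t i) (c * (2 * p) / dist z (r i) ^ α)
          ≤ ∑ i ∈ A, (9 / 4) ^ α * w j i := by
            refine Finset.sum_le_sum fun i hi => blocking_le_mul (ht i (hA hi)) (hJpos i (hA' hi))
              (hIpos j (hA hj) i (hA hi)) (Real.one_le_rpow (by norm_num) hα.le) ?_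
            refine div_rpow_le_mul_div_rpow hα.le (by positivity) (hdpos j (hA hj) i (hA hi))
              (hz i (hA' hi)) (by norm_num) ?_
            have h1 := not_le.1 (Finset.mem_filter.1 hi).2
            have h2 := hmin i hi
            have h3 := dist_triangle (s j) z (r i)
            have h4 := dist_triangle z (r i) (s i)
            rw [dist_comm (s j) z] at h3
            rw [dist_comm (r i) (s i)] at h4
            linarith
        _ ≤ (9 / 4) ^ α * ∑ i ∈ S, w j i := by
            rw [← Finset.mul_sum]
            gcongr
            exact fun i hi _ => hw0 j (hA hj) i hi
        _ ≤ (9 / 4) ^ α * (2 * C₁) := by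
            gcongr
            exact (Finset.mem_filter.1 (hA' hj)).2

end CancellationBounded
end Geometry

/-! ### Decoding -/

section Decoding

variable {n Pmax : ℕ} {L : LinkSet n} {α β noise : ℝ} {a : Profile n Pmax} {i j k : Fin n}

lemma fullPower_ne_zero (h : 1 ≤ Pmax) : Fin.last Pmax ≠ 0 := fun h0 =>
  absurd (congrArg Fin.val h0) (by simpa using by omega)

lemma LinkSet.dist_pos (L : LinkSet n) (i j : Fin n) : 0 < dist (L.sender i) (L.receiver j) :=
  one_pos.trans_le (L.one_le_dist i j)

lemma LinkSet.length_le_Delta (L : LinkSet n) (i : Fin n) :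
    dist (L.sender i) (L.receiver i) ≤ L.Delta :=
  le_ciSup (f := fun i => dist (L.sender i) (L.receiver i)) (Set.finite_range _).bddAbove i

lemma LinkSet.one_le_Delta (L : LinkSet n) : 1 ≤ L.Delta := by
  obtain ⟨i, -, -⟩ := L.exists_dist_eq_one
  exact (L.one_le_dist i i).trans (L.length_le_Delta i)

lemma received_nonneg : 0 ≤ received L α a i j :=
  div_nonneg (Nat.cast_nonneg _) (Real.rpow_nonneg dist_nonneg _)

lemma received_le : received L α a i j ≤ Pmax / dist (L.sender i) (L.receiver j) ^ α := by
  unfold received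
  gcongr
  exact Nat.lt_succ_iff.1 (a i).2

lemma received_pos (h : a i ≠ 0) : 0 < received L α a i j :=
  div_pos (Nat.cast_pos.2 (Nat.pos_of_ne_zero fun h0 => h (Fin.ext h0)))
    (Real.rpow_pos_of_pos (L.dist_pos i j) _)

lemma received_eq_zero (h : a i = 0) : received L α a i j = 0 := by
  simp [received, h]

lemma ne_zero_of_received_pos (h : 0 < received L α a i j) : a i ≠ 0 := fun h0 =>
  h.ne' (received_eq_zero h0)

lemma Decodes.received_pos (h : Decodes L α β noise a j i) : 0 < received L α a i j := by
  cases h; assumption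

lemma Decodes.of_stronger (h : Decodes L α β noise a j i)
    (hk : received L α a i j < received L α a k j) : Decodes L α β noise a j k := by
  cases h with
  | intro _ _ _ hs => exact hs k hk

lemma Decodes.mul_sum_le (h : Decodes L α β noise a j i) (hβ : 0 ≤ β) {A : Finset (Fin n)}
    (hi : i ∉ A) (hA : ∀ k ∈ A, received L α a k j ≤ received L α a i j) :
    β * (∑ k ∈ A, received L α a k j + noise) ≤ received L α a i j := by
  cases h with
  | intro _ _ hs _ =>
    refine le_trans (mul_le_mul_of_nonneg_left (add_le_add_left ?_ _) hβ) hs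
    refine Finset.sum_le_sum_of_subset_of_nonneg (fun k hk => ?_) fun _ _ _ => received_nonneg
    simp only [Finset.mem_filter, Finset.mem_univ, true_and]
    exact ⟨fun h => hi (h ▸ hk), hA k hk⟩

/-- A signal that beats all the others together is decoded. -/
lemma decodes_of_forall_others (hβ : 1 < β) (hN : 0 ≤ noise) (ha : a i ≠ 0)
    (h : β * (∑ k with k ≠ i, received L α a k j + noise) ≤ received L α a i j) :
    Decodes L α β noise a j i := by
  refine Decodes.intro i (received_pos ha) (le_trans ?_ h) fun k hk => ?_
  · gcongr with k
    · exact fun _ _ _ => received_nonneg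
    · exact fun h => h.1
  · exfalso
    have hki : k ≠ i := fun h => by rw [h] at hk; exact lt_irrefl _ hk
    have h1 : received L α a k j ≤ ∑ k with k ≠ i, received L α a k j :=
      Finset.single_le_sum (f := fun k => received L α a k j) (fun _ _ => received_nonneg)
        (by simpa using hki)
    have h2 : 0 ≤ received L α a k j := received_nonneg
    nlinarith

/-- If all signals that arrive at a receiver are strong enough against the sum of the weaker ones,
then all of them are decoded, one after the other. -/
lemma decodes_of_forall_sinr
    (h : ∀ i, 0 < received L α a i j → ∀ A : Finset (Fin n), i ∉ A →
      (∀ k ∈ A, received L α a k j ≤ received L α a i j) →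
      β * (∑ k ∈ A, received L α a k j + noise) ≤ received L α a i j)
    (hi : 0 < received L α a i j) : Decodes L α β noise a j i := by
  have key : ∀ N : ℕ, ∀ i, 0 < received L α a i j →
      (Finset.univ.filter fun k => received L α a i j < received L α a k j).card ≤ N →
      Decodes L α β noise a j i := by
    intro N
    induction N with
    | zero =>
      intro i hi hN
      refine Decodes.intro i hi (h i hi _ (by simp) (by simp)) fun k hk => ?_
      rw [Nat.le_zero, Finset.card_eq_zero] at hN
      have : k ∈ Finset.univ.filter fun k => received L α a i j < received L α a k j := by
        simpa using hk
      rw [hN] at this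
      exact absurd this (Finset.notMem_empty _)
    | succ N ih =>
      intro i hi hN
      refine Decodes.intro i hi (h i hi _ (by simp) (by simp)) fun k hk => ?_
      refine ih k (hi.trans hk) (Nat.lt_succ_iff.1 (lt_of_lt_of_le ?_ hN))
      refine Finset.card_lt_card ⟨fun l hl => ?_, fun hsub => ?_⟩
      · simp only [Finset.mem_filter, Finset.mem_univ, true_and] at hl ⊢
        exact hk.trans hl
      · have := hsub (show k ∈ _ by simpa using hk)
        simp at this
  exact key _ i hi le_rfl

/-- Two equally strong signals prevent the decoding of each other and of all weaker signals. -/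
lemma not_decodes_of_tie (hβ : 1 < β) (hN : 0 ≤ noise) {k l : Fin n} (hkl : k ≠ l)
    (heq : received L α a k j = received L α a l j) (hpos : 0 < received L α a k j)
    (hi : received L α a i j ≤ received L α a k j) : ¬ Decodes L α β noise a j i := by
  have key : ∀ x y, x ≠ y → received L α a x j = received L α a y j → 0 < received L α a x j →
      ¬ Decodes L α β noise a j x := by
    intro x y hxy he hx hdec
    have := hdec.mul_sum_le (by linarith) (A := {y}) (by simpa using hxy) (by simp [he])
    rw [Finset.sum_singleton, ← he] at this
    nlinarith
  intro hdec
  rcases hi.lt_or_eq with hlt | he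
  · exact key k l hkl heq hpos (hdec.of_stronger hlt)
  · by_cases hik : i = k
    · exact key i l (hik ▸ hkl) (he.trans heq) (he ▸ hpos) hdec
    · exact key i k hik he (he ▸ hpos) hdec

lemma Successful.ne_zero (h : Successful L α β noise a i) : a i ≠ 0 :=
  ne_zero_of_received_pos h.received_pos

/-- The signals of strength at most `b` at a successful receiver: the strongest of them is decoded
or is weaker than the own signal, which is decoded. -/
lemma Successful.sum_le (h : Successful L α β noise a j) (hβ : 1 < β) (hN : 0 ≤ noise) {b : ℝ}
    (hb : received L α a j j ≤ b) {A : Finset (Fin n)} (hA : ∀ k ∈ A, received L α a k j ≤ b) :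
    ∑ k ∈ A, received L α a k j ≤ 2 * b := by
  classical
  have hb0 : 0 ≤ b := received_nonneg.trans hb
  have key : ∀ m ∈ insert j A, Decodes L α β noise a j m →
      (∀ k ∈ A, received L α a k j ≤ received L α a m j) → ∑ k ∈ A, received L α a k j ≤ 2 * b := by
    intro m hm hdec hmax
    have hmb : received L α a m j ≤ b := by
      rcases Finset.mem_insert.1 hm with rfl | hm
      · exact hb
      · exact hA m hm
    have h1 := hdec.mul_sum_le (by linarith) (A := A.erase m) (Finset.notMem_erase _ _)
      fun k hk => hmax k (Finset.mem_of_mem_erase hk)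
    have h2 : ∑ k ∈ A, received L α a k j
        ≤ ∑ k ∈ A.erase m, received L α a k j + received L α a m j := by
      by_cases hmA : m ∈ A
      · rw [Finset.sum_erase_add _ _ hmA]
      · rw [Finset.erase_eq_of_notMem hmA]
        linarith [received_nonneg (L := L) (α := α) (a := a) (i := m) (j := j)]
    have h3 : 0 ≤ ∑ k ∈ A.erase m, received L α a k j :=
      Finset.sum_nonneg fun _ _ => received_nonneg
    nlinarith
  obtain ⟨m, hm, hmax⟩ := (insert j A).exists_max_image (fun k => received L α a k j)
    ⟨j, Finset.mem_insert_self _ _⟩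
  have hmax' : ∀ k ∈ A, received L α a k j ≤ received L α a m j := fun k hk =>
    hmax k (Finset.mem_insert_of_mem hk)
  rcases (hmax j (Finset.mem_insert_self _ _)).lt_or_eq with hlt | heq
  · exact key m hm (h.of_stronger hlt) hmax'
  · exact key j (Finset.mem_insert_self _ _) h fun k hk => (hmax' k hk).trans heq.ge

lemma cancellationBounded_of_successful (hβ : 1 < β) (hN : 0 ≤ noise) {O : Finset (Fin n)}
    (hO : ∀ i ∈ O, Successful L α β noise a i) :
    CancellationBounded L.sender L.receiver (fun i => ((a i : ℕ) : ℝ)) α O where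
  power_pos i hi := Nat.cast_pos.2 (Nat.pos_of_ne_zero fun h0 => (hO i hi).ne_zero (Fin.ext h0))
  dist_pos i _ j _ := L.dist_pos i j
  sum_le j hj _ hb := (hO j hj).sum_le hβ hN hb fun _ hk => (Finset.mem_filter.1 hk).2

end Decoding

section Affectance

variable {n Pmax : ℕ} {L : LinkSet n} {α β noise : ℝ} {a : Profile n Pmax} {i j k : Fin n}

/-- The interference, scaled by `β`, that receiver `i` tolerates when its own sender uses full
power. -/
noncomputable def tolerance (L : LinkSet n) (α β noise : ℝ) (Pmax : ℕ) (i : Fin n) : ℝ :=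
  Pmax / dist (L.sender i) (L.receiver i) ^ α - β * noise

/-- How much a sender `k` of full power affects the link `i`, if that has full power, too. -/
noncomputable def affectance (L : LinkSet n) (α β noise : ℝ) (Pmax : ℕ) (k i : Fin n) : ℝ :=
  blocking (tolerance L α β noise Pmax i) (β * Pmax / dist (L.sender k) (L.receiver i) ^ α)

lemma Successful.tolerance_nonneg (h : Successful L α β noise a i) (hβ : 1 < β) :
    0 ≤ tolerance L α β noise Pmax i := by
  have h1 := h.mul_sum_le (by linarith) (A := ∅) (by simp) (by simp)
  rw [Finset.sum_empty, zero_add] at h1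
  exact sub_nonneg.2 (h1.trans received_le)

lemma affectance_nonneg (hβ : 1 < β) (ht : 0 ≤ tolerance L α β noise Pmax i) :
    0 ≤ affectance L α β noise Pmax k i :=
  blocking_nonneg ht (by positivity)

lemma affectance_le_one (hβ : 1 < β) (ht : 0 ≤ tolerance L α β noise Pmax i) :
    affectance L α β noise Pmax k i ≤ 1 :=
  blocking_le_one ht (by positivity)

/-- The constant in the bound for the total affectance. -/
noncomputable def affectanceConst (α β : ℝ) : ℝ :=
  (4 * 3 ^ α + 2 * β * (4 * (9 / 4) ^ α + 8 * 36 ^ α / (1 - (1 / 2) ^ α))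
      + (4 * 40 ^ α + 8 * 1080 ^ α)) * (1 + (1 + α) / Real.log 2) +
    (8 * (27 * 2 ^ (1 / α)) ^ α + (9 / 4) ^ α * (2 * (8 * (9 * (2 ^ (1 / α)) ^ 2) ^ α + 2)))

lemma affectanceConst_pos (hα : 0 < α) (hβ : 1 < β) : 0 < affectanceConst α β := by
  have hq1 : (1 / 2 : ℝ) ^ α < 1 := Real.rpow_lt_one (by norm_num) (by norm_num) hα
  have hq : 0 < 1 - (1 / 2 : ℝ) ^ α := by linarith
  have hl2 : 0 < Real.log 2 := Real.log_pos one_lt_two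
  unfold affectanceConst
  positivity

/-- A quarter of the links of any successful set is affected only logarithmically by each sender. If
half of the links are well above the noise, this follows from the count over dyadic scales.
Otherwise half of the links can hardly overcome the noise; they all use at least half of the full
power and have comparable lengths, but their tolerances are arbitrary. -/
lemma exists_subset_sum_affectance_le (hα : 0 < α) (hβ : 1 < β) (hN : 0 ≤ noise) (hPmax : 1 ≤ Pmax)
    {O : Finset (Fin n)} (hO : ∀ i ∈ O, Successful L α β noise a i) :
    ∃ O' ⊆ O, O.card ≤ 4 * O'.card ∧ ∀ k, ∑ i ∈ O', affectance L α β noise Pmax k i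
      ≤ affectanceConst α β * (1 + Real.log (L.Delta * Pmax)) := by
  classical
  have hc := cancellationBounded_of_successful hβ hN hO
  have hq1 : (1 / 2 : ℝ) ^ α < 1 := Real.rpow_lt_one (by norm_num) (by norm_num) hα
  have hq : 0 < 1 - (1 / 2 : ℝ) ^ α := by linarith
  have hl2 : 0 < Real.log 2 := Real.log_pos one_lt_two
  have hP1 : (1 : ℝ) ≤ Pmax := by exact_mod_cast hPmax
  have hP0 : (0 : ℝ) < Pmax := by linarith
  have hlog : 0 ≤ Real.log (L.Delta * Pmax) :=
    Real.log_nonneg (one_le_mul_of_one_le_of_one_le L.one_le_Delta hP1)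
  have hpow : ∀ i ∈ O, (1 : ℝ) ≤ ((a i : ℕ) : ℝ) ∧ ((a i : ℕ) : ℝ) ≤ Pmax := fun i hi =>
    ⟨Nat.one_le_cast.2 (Nat.cast_pos.1 (hc.power_pos i hi)),
      Nat.cast_le.2 (Nat.lt_succ_iff.1 (a i).2)⟩
  have hDa : ∀ i, 0 < dist (L.sender i) (L.receiver i) ^ α := fun i =>
    Real.rpow_pos_of_pos (L.dist_pos i i) _
  set S := O.filter fun i => β * noise * dist (L.sender i) (L.receiver i) ^ α ≤ Pmax / 2 with hS
  set W := O.filter fun i => ¬ β * noise * dist (L.sender i) (L.receiver i) ^ α ≤ Pmax / 2 with hW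
  have iS : S ⊆ O := Finset.filter_subset _ _
  have iW : W ⊆ O := Finset.filter_subset _ _
  have hcard : S.card + W.card = O.card := Finset.card_filter_add_card_filter_not _
  unfold affectanceConst
  set C₁ : ℝ := 4 * 3 ^ α + 2 * β * (4 * (9 / 4) ^ α + 8 * 36 ^ α / (1 - (1 / 2) ^ α))
      + (4 * 40 ^ α + 8 * 1080 ^ α) with hC₁
  set C₂ : ℝ :=
    8 * (27 * 2 ^ (1 / α)) ^ α + (9 / 4) ^ α * (2 * (8 * (9 * (2 ^ (1 / α)) ^ 2) ^ α + 2)) with hC₂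
  have hC₁0 : 0 < C₁ := by positivity
  have hC₂0 : 0 < C₂ := by positivity
  -- `S` are the links well above the noise, `W` those that can hardly overcome it.
  rcases le_total W.card S.card with hle | hle
  · refine ⟨S, iS, by omega, fun k => ?_⟩
    refine (hc.sum_le_log hα iS (z := L.sender k) (K := 2 * β) hP1 L.one_le_Delta (by positivity)
      (fun i hi => hpow i (iS hi)) (fun i _ => ⟨L.one_le_dist i i, L.length_le_Delta i⟩)
      (w := fun i => affectance L α β noise Pmax k i)
      (fun i hi => affectance_le_one hβ ((hO i (iS hi)).tolerance_nonneg hβ))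
      (fun i hi => ?_)).trans ?_
    · have h1 := (Finset.mem_filter.1 hi).2
      have h2 := hDa i
      have h3 := Real.rpow_pos_of_pos (L.dist_pos k i) α
      have ht : Pmax / (2 * dist (L.sender i) (L.receiver i) ^ α) ≤
          tolerance L α β noise Pmax i := by
        have e1 : β * noise ≤ Pmax / 2 / dist (L.sender i) (L.receiver i) ^ α :=
          (le_div_iff₀ h2).2 h1
        have e2 : (Pmax : ℝ) / (2 * dist (L.sender i) (L.receiver i) ^ α)
            = Pmax / dist (L.sender i) (L.receiver i) ^ α
              - Pmax / 2 / dist (L.sender i) (L.receiver i) ^ α := by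
          field_simp
          ring
        rw [e2]
        exact sub_le_sub_left e1 _
      have ht0 : 0 < Pmax / (2 * dist (L.sender i) (L.receiver i) ^ α) := by positivity
      refine (blocking_le_div (ht0.trans_le ht) (by positivity)).trans ?_
      refine (div_le_div_of_nonneg_left (by positivity) ht0 ht).trans (le_of_eq ?_)
      rw [Real.div_rpow dist_nonneg dist_nonneg]
      field_simp
    · rw [← hC₁]
      have hX : 0 ≤ (1 + α) / Real.log 2 := by positivity
      nlinarith [mul_nonneg hC₁0.le hX, mul_nonneg hC₁0.le hlog, mul_nonneg hC₂0.le hlog]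
  · have hWn : ∀ i ∈ W, Pmax / 2 < β * noise * dist (L.sender i) (L.receiver i) ^ α ∧
        β * noise * dist (L.sender i) (L.receiver i) ^ α ≤ ((a i : ℕ) : ℝ) := by
      intro i hi
      refine ⟨not_le.1 (Finset.mem_filter.1 hi).2, ?_⟩
      have h1 := (hO i (iW hi)).mul_sum_le (by linarith) (A := ∅) (by simp) (by simp)
      rw [Finset.sum_empty, zero_add, received, le_div_iff₀ (hDa i)] at h1
      exact h1
    rcases W.eq_empty_or_nonempty with hne | ⟨i₀, hi₀⟩
    · refine ⟨∅, Finset.empty_subset _, ?_, fun k => ?_⟩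
      · rw [hne, Finset.card_empty] at hle hcard
        omega
      · rw [Finset.sum_empty]
        positivity
    have hβN : 0 < β * noise := by
      have := hWn i₀ hi₀
      by_contra! h0
      nlinarith [hDa i₀]
    -- On `W`, `D_i ^ α` lies between `Pmax / (2 * β * noise)` and twice this number.
    set D : ℝ := (Pmax / (2 * (β * noise))) ^ (1 / α) with hD
    have hD0 : 0 < D := Real.rpow_pos_of_pos (by positivity) _
    have hDα : D ^ α = Pmax / (2 * (β * noise)) := by
      rw [hD, ← Real.rpow_mul (by positivity), one_div_mul_cancel hα.ne', Real.rpow_one]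
    have h2α : ((2 : ℝ) ^ (1 / α)) ^ α = 2 := by
      rw [← Real.rpow_mul (by norm_num), one_div_mul_cancel hα.ne', Real.rpow_one]
    have hlen : ∀ i ∈ W, D ≤ dist (L.sender i) (L.receiver i) ∧
        dist (L.sender i) (L.receiver i) ≤ 2 ^ (1 / α) * D := by
      intro i hi
      constructor
      · rw [← Real.rpow_le_rpow_iff hD0.le dist_nonneg hα, hDα, div_le_iff₀ (by positivity)]
        linarith [(hWn i hi).1]
      · rw [← Real.rpow_le_rpow_iff dist_nonneg (by positivity) hα,
          Real.mul_rpow (by positivity) hD0.le, hDα, h2α, mul_div_assoc',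
          le_div_iff₀ (by positivity)]
        linarith [(hWn i hi).2, (hpow i (iW hi)).2]
    have hint : ∀ i ∈ W, ∀ A ⊆ W, i ∉ A → (∀ k ∈ A, received L α a k i ≤ received L α a i i) →
        β * ∑ k ∈ A, received L α a k i ≤ tolerance L α β noise Pmax i := by
      intro i hi A hA hiA hAi
      have h1 := (hO i (iW hi)).mul_sum_le (by linarith) hiA hAi
      have h2 : received L α a i i ≤ Pmax / dist (L.sender i) (L.receiver i) ^ α := received_le
      unfold tolerance
      linarith
    obtain ⟨W', hW', hWcard, hrow⟩ := hc.exists_subset_sum_blocking_le hα iW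
      (p := Pmax / 2) (D := D) (c := β) (t := fun i => tolerance L α β noise Pmax i)
      (by positivity) hD0 (by linarith) (fun i hi => (hO i (iW hi)).tolerance_nonneg hβ)
      (fun i hi => ⟨(hWn i hi).1.le.trans (hWn i hi).2, by linarith [(hpow i (iW hi)).2]⟩)
      hlen hint
    refine ⟨W', hW'.trans iW, by omega, fun k => ?_⟩
    have := hrow (L.sender k) fun i _ => L.dist_pos k i
    rw [mul_div_cancel₀ _ (two_ne_zero)] at this
    refine this.trans ?_
    have hX : 0 ≤ (1 + α) / Real.log 2 := by positivity
    nlinarith [mul_nonneg hC₁0.le hX, mul_nonneg hC₁0.le hlog, mul_nonneg hC₂0.le hlog,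
      mul_nonneg (mul_nonneg hC₁0.le hX) hlog]

end Affectance

/-! ### Regret and the upper bound -/

section Regret

variable {n Pmax T : ℕ} {L : LinkSet n} {α β noise ε : ℝ} {a : Profile n Pmax} {i : Fin n}
  {H : Fin T → Profile n Pmax}

open Classical in
/-- The indicator of success. -/
noncomputable def success (L : LinkSet n) (α β noise : ℝ) (a : Profile n Pmax) (i : Fin n) : ℝ :=
  if Successful L α β noise a i then 1 else 0

/-- The indicator of a transmission. -/
noncomputable def active (a : Profile n Pmax) (i : Fin n) : ℝ := if a i = 0 then 0 else 1

lemma active_nonneg : 0 ≤ active a i := by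
  unfold active
  split_ifs <;> norm_num

lemma utility_eq : utility L α β noise a i = 2 * success L α β noise a i - active a i := by
  unfold utility success active
  by_cases h0 : a i = 0
  · have : ¬ Successful L α β noise a i := fun h => h.ne_zero h0
    simp [h0, this]
  · by_cases h : Successful L α β noise a i
    · simp only [h0, h, if_true, if_false]
      norm_num
    · simp [h0, h]

lemma success_le_active : success L α β noise a i ≤ active a i := by
  unfold success active
  by_cases h0 : a i = 0
  · have : ¬ Successful L α β noise a i := fun h => h.ne_zero h0
    simp [h0, this]
  · simp only [h0, if_false]
    split_ifs <;> norm_num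

lemma utility_le_one : utility L α β noise a i ≤ 1 := by
  unfold utility
  split_ifs <;> norm_num

lemma numSuccessful_eq_sum :
    (numSuccessful L α β noise a : ℝ) = ∑ i, success L α β noise a i := by
  classical
  unfold numSuccessful success
  rw [Finset.sum_boole]

lemma regret_le_iff (hT : 0 < T) :
    regret L α β noise H i ≤ ε ↔ ∀ x : Fin (Pmax + 1),
      ∑ t, utility L α β noise (Function.update (H t) i x) i
        ≤ ∑ t, utility L α β noise (H t) i + ε * T := by
  have hT' : (0 : ℝ) < T := by exact_mod_cast hT
  unfold regret
  rw [sub_le_iff_le_add, ciSup_le_iff (Set.finite_range _).bddAbove]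
  refine forall_congr' fun x => ?_
  rw [one_div, inv_mul_le_iff₀ hT']
  constructor <;> intro h <;> refine h.trans (le_of_eq ?_) <;> field_simp <;> ring

/-- If a link with full power fails, then the affectance by the other transmitting links is at least
one half. -/
lemma one_sub_le_utility (hβ : 1 < β) (hN : 0 ≤ noise) (hPmax : 1 ≤ Pmax)
    (ht : 0 ≤ tolerance L α β noise Pmax i) :
    1 - 4 * ∑ k, active a k * affectance L α β noise Pmax k i
      ≤ utility L α β noise (Function.update a i (Fin.last Pmax)) i := by
  classical
  have hlast := fullPower_ne_zero hPmax
  have hterm : ∀ k, 0 ≤ active a k * affectance L α β noise Pmax k i := fun k =>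
    mul_nonneg active_nonneg (affectance_nonneg hβ ht)
  have hsum0 := Finset.sum_nonneg fun k (_ : k ∈ Finset.univ) => hterm k
  unfold utility
  rw [Function.update_self, if_neg hlast]
  split_ifs with hs
  · linarith
  have hfail : ¬ β * (∑ k with k ≠ i,
      received L α (Function.update a i (Fin.last Pmax)) k i + noise)
      ≤ received L α (Function.update a i (Fin.last Pmax)) i i := fun h =>
    hs (decodes_of_forall_others hβ hN (by rwa [Function.update_self]) h)
  set A := Finset.univ.filter fun k => k ≠ i ∧ a k ≠ 0 with hA
  have hlt : tolerance L α β noise Pmax i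
      < ∑ k ∈ A, β * Pmax / dist (L.sender k) (L.receiver i) ^ α := by
    have e : received L α (Function.update a i (Fin.last Pmax)) i i
        = Pmax / dist (L.sender i) (L.receiver i) ^ α := by
      simp [received]
    rw [e, not_le] at hfail
    have h1 : ∑ k with k ≠ i, received L α (Function.update a i (Fin.last Pmax)) k i
        ≤ ∑ k ∈ A, Pmax / dist (L.sender k) (L.receiver i) ^ α := by
      rw [← Finset.sum_subset (s₁ := A)]
      · exact Finset.sum_le_sum fun k _ => received_le
      · exact fun k hk => Finset.mem_filter.2 ⟨Finset.mem_univ k, (Finset.mem_filter.1 hk).2.1⟩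
      · intro k hk hkA
        have hki := (Finset.mem_filter.1 hk).2
        refine received_eq_zero ?_
        rw [Function.update_of_ne hki]
        by_contra h0
        exact hkA (Finset.mem_filter.2 ⟨Finset.mem_univ k, hki, h0⟩)
    unfold tolerance
    rw [Finset.sum_congr rfl fun k _ => mul_div_assoc β _ _, ← Finset.mul_sum]
    nlinarith
  have h2 := half_le_sum_blocking ht (fun k _ => by positivity) hlt
  have h3 : ∑ k ∈ A, affectance L α β noise Pmax k i
      ≤ ∑ k, active a k * affectance L α β noise Pmax k i := by
    refine le_trans (Finset.sum_le_sum fun k hk => ?_)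
      (Finset.sum_le_sum_of_subset_of_nonneg (Finset.subset_univ A) fun k _ _ => hterm k)
    rw [active, if_neg (Finset.mem_filter.1 hk).2.2, one_mul]
  change 1 / 2 ≤ ∑ k ∈ A, affectance L α β noise Pmax k i at h2
  linarith

end Regret

section UpperBound

variable {n Pmax T : ℕ} {L : LinkSet n} {α β noise ε : ℝ} {H : Fin T → Profile n Pmax}

lemma value_eq (hT : 0 < T) : value L α β noise H
    = ENNReal.ofReal ((∑ t, ∑ i, success L α β noise (H t) i) / T) := by
  have hT' : (0 : ℝ) < T := by exact_mod_cast hT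
  unfold value
  rw [ENNReal.ofReal_div_of_pos hT', ENNReal.ofReal_natCast]
  congr 1
  simp_rw [← numSuccessful_eq_sum]
  rw [← Nat.cast_sum, ← Nat.cast_sum, ENNReal.ofReal_natCast]

lemma exists_opt_eq (L : LinkSet n) (α β noise : ℝ) (Pmax : ℕ) :
    ∃ a : Profile n Pmax, opt L α β noise Pmax = numSuccessful L α β noise a := by
  obtain ⟨a, -, ha⟩ := Finset.exists_mem_eq_sup Finset.univ Finset.univ_nonempty
    fun a : Profile n Pmax => numSuccessful L α β noise a
  exact ⟨a, ha⟩

/-- In a low-regret history, full power is on average not better than the actual play. Summing this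
over a set of links that no sender affects by more than `Λ` bounds the number of transmissions from
below, and about half of these are successful because silence is not much better, either. -/
lemma card_mul_le_sum_success (hβ : 1 < β) (hN : 0 ≤ noise) (hPmax : 1 ≤ Pmax) (hε : 0 ≤ ε)
    (hεn : ε ≤ 1 / 20 / n) (hH : IsRegretHistory L α β noise ε H) {O : Finset (Fin n)} {Λ : ℝ}
    (hO : O.Nonempty) (ht : ∀ i ∈ O, 0 ≤ tolerance L α β noise Pmax i) (hΛ0 : 0 ≤ Λ)
    (hΛ : ∀ k, ∑ i ∈ O, affectance L α β noise Pmax k i ≤ Λ) :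
    O.card * (T : ℝ) ≤ 8 * (1 + 4 * Λ) * ∑ t, ∑ i, success L α β noise (H t) i := by
  classical
  obtain ⟨hT, hreg⟩ := hH
  have hT' : (0 : ℝ) < T := by exact_mod_cast hT
  obtain ⟨i₀, hi₀⟩ := hO
  have hn : (1 : ℝ) ≤ n := by exact_mod_cast i₀.pos
  have hnε : n * ε ≤ 1 / 20 := by
    rw [le_div_iff₀ (by linarith)] at hεn
    linarith
  have hε1 : ε ≤ 1 / 20 := by nlinarith
  set V := ∑ t, ∑ i, success L α β noise (H t) i with hV
  set Y := ∑ t, ∑ i, active (H t) i with hY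
  have hAct : ∀ i, ∑ t, active (H t) i ≤ Y := fun i =>
    Finset.sum_le_sum fun t _ => Finset.single_le_sum (f := fun i => active (H t) i)
      (fun _ _ => active_nonneg) (Finset.mem_univ i)
  have hsilent : Y ≤ 2 * V + n * ε * T := by
    have h1 : ∀ i, ∑ t, active (H t) i ≤ 2 * ∑ t, success L α β noise (H t) i + ε * T := by
      intro i
      have := (regret_le_iff hT).1 (hreg i) 0
      rw [Finset.sum_eq_zero fun t _ => by rw [utility, Function.update_self, if_pos rfl]] at this
      simp_rw [utility_eq] at this
      rw [Finset.sum_sub_distrib, ← Finset.mul_sum] at this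
      linarith
    have h2 := Finset.sum_le_sum fun i (_ : i ∈ Finset.univ) => h1 i
    rw [Finset.sum_add_distrib, ← Finset.mul_sum, Finset.sum_const, Finset.card_univ,
      Fintype.card_fin, nsmul_eq_mul, Finset.sum_comm, Finset.sum_comm (s := Finset.univ)
      (f := fun i t => success L α β noise (H t) i)] at h2
    linarith
  have hfull : ∀ i, 0 ≤ tolerance L α β noise Pmax i →
      T * (1 - ε) ≤ ∑ t, active (H t) i
        + 4 * ∑ t, ∑ k, active (H t) k * affectance L α β noise Pmax k i := by
    intro i hi
    have h1 := (regret_le_iff hT).1 (hreg i) (Fin.last Pmax)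
    have h2 := Finset.sum_le_sum fun t (_ : t ∈ Finset.univ) =>
      one_sub_le_utility (a := H t) hβ hN hPmax hi
    rw [Finset.sum_sub_distrib, ← Finset.mul_sum, Finset.sum_const, Finset.card_univ,
      Fintype.card_fin, nsmul_eq_mul, mul_one] at h2
    have h3 : ∑ t, utility L α β noise (H t) i ≤ ∑ t, active (H t) i := by
      refine Finset.sum_le_sum fun t _ => ?_
      rw [utility_eq]
      linarith [success_le_active (L := L) (α := α) (β := β) (noise := noise) (a := H t) (i := i)]
    linarith
  -- The bound for a single link shows that there are enough transmissions to neglect the regrets,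
  -- which add up to at most `n * ε ≤ 1 / 20`.
  have hT5 : T * (1 - ε) ≤ 5 * Y := by
    have h1 := hfull i₀ (ht i₀ hi₀)
    have h2 : ∑ t, ∑ k, active (H t) k * affectance L α β noise Pmax k i₀ ≤ Y := by
      refine Finset.sum_le_sum fun t _ => Finset.sum_le_sum fun k _ => ?_
      exact mul_le_of_le_one_right active_nonneg (affectance_le_one hβ (ht i₀ hi₀))
    linarith [hAct i₀]
  have hVY : Y ≤ 4 * V := by nlinarith
  have hcard : O.card * (T * (1 - ε)) ≤ (1 + 4 * Λ) * Y := by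
    have h1 := Finset.sum_le_sum fun i (hi : i ∈ O) => hfull i (ht i hi)
    rw [Finset.sum_const, nsmul_eq_mul, Finset.sum_add_distrib, ← Finset.mul_sum] at h1
    have h2 : ∑ i ∈ O, ∑ t, active (H t) i ≤ Y := by
      rw [Finset.sum_comm]
      exact Finset.sum_le_sum fun t _ => Finset.sum_le_sum_of_subset_of_nonneg
        (Finset.subset_univ _) fun _ _ _ => active_nonneg
    have h3 : ∑ i ∈ O, ∑ t, ∑ k, active (H t) k * affectance L α β noise Pmax k i ≤ Λ * Y := by
      rw [Finset.sum_comm, hY, Finset.mul_sum]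
      refine Finset.sum_le_sum fun t _ => ?_
      rw [Finset.sum_comm, Finset.mul_sum]
      refine Finset.sum_le_sum fun k _ => ?_
      rw [← Finset.mul_sum, mul_comm]
      exact mul_le_mul_of_nonneg_right (hΛ k) active_nonneg
    linarith
  have h5 : (O.card : ℝ) * T ≤ 2 * (O.card * (T * (1 - ε))) := by
    have : (0 : ℝ) ≤ O.card * T := by positivity
    nlinarith
  have h6 : (1 + 4 * Λ) * Y ≤ (1 + 4 * Λ) * (4 * V) := by gcongr
  linarith

lemma priceOfTotalAnarchy_le (hα : 0 < α) (hβ : 1 < β) (hN : 0 ≤ noise) (hPmax : 1 ≤ Pmax)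
    (hε : 0 ≤ ε) (hεn : ε ≤ 1 / 20 / n) :
    priceOfTotalAnarchy L α β noise Pmax ε ≤ ENNReal.ofReal
      (32 * (1 + 4 * affectanceConst α β) * (1 + Real.log (L.Delta * Pmax))) := by
  classical
  have hP1 : (1 : ℝ) ≤ Pmax := by exact_mod_cast hPmax
  have hlog : 0 ≤ Real.log (L.Delta * Pmax) :=
    Real.log_nonneg (one_le_mul_of_one_le_of_one_le L.one_le_Delta hP1)
  have hC := affectanceConst_pos hα hβ
  set C := 32 * (1 + 4 * affectanceConst α β) * (1 + Real.log (L.Delta * Pmax)) with hCdef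
  have hC0 : 0 < C := by positivity
  unfold priceOfTotalAnarchy
  refine ENNReal.div_le_of_le_mul ?_
  have hinf : (opt L α β noise Pmax : ℝ≥0∞) / ENNReal.ofReal C
      ≤ worstRegretValue L α β noise Pmax ε := by
    refine le_iInf fun T => le_iInf fun H => le_iInf fun hH => ?_
    have hT' : (0 : ℝ) < T := by exact_mod_cast hH.1
    rw [value_eq hH.1]
    obtain ⟨a, ha⟩ := exists_opt_eq L α β noise Pmax
    set O := Finset.univ.filter fun i => Successful L α β noise a i with hO
    have hOcard : opt L α β noise Pmax = O.card := ha
    have hOs : ∀ i ∈ O, Successful L α β noise a i := fun i hi => (Finset.mem_filter.1 hi).2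
    obtain ⟨O', hO', hcard, hrow⟩ := exists_subset_sum_affectance_le hα hβ hN hPmax hOs
    rcases O'.eq_empty_or_nonempty with hne | hne
    · rw [hne, Finset.card_empty] at hcard
      rw [hOcard, show O.card = 0 by omega, Nat.cast_zero, ENNReal.zero_div]
      exact zero_le
    have key := card_mul_le_sum_success hβ hN hPmax hε hεn hH hne
      (fun i hi => (hOs i (hO' hi)).tolerance_nonneg hβ) (by positivity) hrow
    rw [← ENNReal.ofReal_natCast, ← ENNReal.ofReal_div_of_pos hC0]
    refine ENNReal.ofReal_le_ofReal ?_
    set V := ∑ t, ∑ i, success L α β noise (H t) i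
    have hV0 : 0 ≤ V := Finset.sum_nonneg fun t _ => Finset.sum_nonneg fun i _ => by
      unfold success
      split_ifs <;> norm_num
    rw [div_le_div_iff₀ hC0 hT', hOcard]
    have h4 : (O.card : ℝ) ≤ 4 * O'.card := by exact_mod_cast hcard
    have h5 : (O.card : ℝ) * T ≤ 4 * (O'.card * T) := by nlinarith
    have h6 : 4 * (8 * (1 + 4 * (affectanceConst α β * (1 + Real.log (L.Delta * Pmax)))) * V)
        ≤ V * C := by
      rw [hCdef]
      nlinarith [mul_nonneg hV0 hlog]
    linarith
  rwa [ENNReal.div_le_iff (by simpa using hC0) ENNReal.ofReal_ne_top, mul_comm] at hinf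

end UpperBound

/-! ### Histories without regret and decodable chains -/

section LowerBound

variable {n Pmax T : ℕ} {L : LinkSet n} {α β ν : ℝ}

/-- A history without regret in which at most six links ever transmit has value at most `6`. -/
lemma le_priceOfTotalAnarchy {H : Fin T → Profile n Pmax} {B : Finset (Fin n)} {a : Profile n Pmax}
    {q : ℕ} {x ε : ℝ} (hT : 0 < T) (hε : 0 ≤ ε)
    (hH : ∀ i y, ∑ t, utility L α β 0 (Function.update (H t) i y) i ≤ ∑ t, utility L α β 0 (H t) i)
    (hB : B.card ≤ 6) (hHB : ∀ t, ∀ k ∉ B, H t k = 0) (ha : q ≤ numSuccessful L α β 0 a)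
    (hx : x ≤ q / 6) :
    ENNReal.ofReal x ≤ priceOfTotalAnarchy L α β 0 Pmax ε := by
  have hT' : (0 : ℝ) < T := by exact_mod_cast hT
  have hreg : IsRegretHistory L α β 0 ε H :=
    ⟨hT, fun i => (regret_le_iff hT).2 fun y => (hH i y).trans (by simp; positivity)⟩
  have hval : value L α β 0 H ≤ ENNReal.ofReal 6 := by
    rw [value_eq hT]
    refine ENNReal.ofReal_le_ofReal ?_
    rw [div_le_iff₀ hT']
    have : ∀ t, ∑ i, success L α β 0 (H t) i ≤ 6 := by
      intro t
      rw [← Finset.sum_subset (Finset.subset_univ B)]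
      · refine (Finset.sum_le_card_nsmul B _ 1 fun i _ => ?_).trans ?_
        · unfold success
          split_ifs <;> norm_num
        · rw [nsmul_eq_mul, mul_one]
          exact_mod_cast hB
      · intro k _ hk
        exact if_neg fun h => h.ne_zero (hHB t k hk)
    refine (Finset.sum_le_card_nsmul Finset.univ _ 6 fun t _ => this t).trans ?_
    rw [Finset.card_univ, Fintype.card_fin, nsmul_eq_mul, mul_comm]
  have hworst : worstRegretValue L α β 0 Pmax ε ≤ ENNReal.ofReal 6 := by
    unfold worstRegretValue
    exact iInf₂_le_of_le T H (iInf_le_of_le hreg hval)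
  have hopt : q ≤ opt L α β 0 Pmax :=
    ha.trans (Finset.le_sup (f := fun a : Profile n Pmax => numSuccessful L α β 0 a)
      (Finset.mem_univ a))
  unfold priceOfTotalAnarchy
  calc ENNReal.ofReal x ≤ ENNReal.ofReal (q / 6) := ENNReal.ofReal_le_ofReal hx
    _ = (q : ℝ≥0∞) / ENNReal.ofReal 6 := by
        rw [ENNReal.ofReal_div_of_pos (by norm_num), ENNReal.ofReal_natCast]
    _ ≤ (opt L α β 0 Pmax : ℝ≥0∞) / worstRegretValue L α β 0 Pmax ε :=
        ENNReal.div_le_div (by exact_mod_cast hopt) hworst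

lemma le_numSuccessful {a : Profile n Pmax} {q : ℕ} (hq : q ≤ n)
    (h : ∀ i : Fin n, (i : ℕ) < q → Successful L α β 0 a i) : q ≤ numSuccessful L α β 0 a := by
  classical
  unfold numSuccessful
  calc q = (Finset.univ.image (Fin.castLE hq)).card := by
        rw [Finset.card_image_of_injective _ (Fin.castLE_injective hq), Finset.card_univ,
          Fintype.card_fin]
    _ ≤ _ := by
        refine Finset.card_le_card fun i hi => ?_
        obtain ⟨k, -, rfl⟩ := Finset.mem_image.1 hi
        exact Finset.mem_filter.2 ⟨Finset.mem_univ _, h _ k.2⟩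

/-- A receiver decodes all signals of strengths `c * m ^ k` for `k < q`, if nothing else arrives. -/
lemma decodes_of_geometric {a : Profile n Pmax} {j : Fin n} {m c : ℝ} {q : ℕ} (hβ : 1 < β)
    (hm : β + 1 ≤ m) (hc : 0 < c)
    (h : ∀ k : Fin n, received L α a k j = if (k : ℕ) < q then c * m ^ (k : ℕ) else 0)
    {i : Fin n} (hi : (i : ℕ) < q) : Decodes L α β 0 a j i := by
  have hm0 : 0 < m := by linarith
  refine decodes_of_forall_sinr (fun i hi A hiA hA => ?_) (by rw [h, if_pos hi]; positivity)
  have hiq : (i : ℕ) < q := by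
    by_contra hiq
    rw [h, if_neg hiq] at hi
    exact lt_irrefl _ hi
  have h1 : ∑ k ∈ A, received L α a k j ≤ ∑ x ∈ Finset.range i, c * m ^ x := by
    rw [Finset.sum_congr rfl fun k _ => h k, ← Finset.sum_filter,
      ← Finset.sum_image (f := fun x : ℕ => c * m ^ x) (g := fun k : Fin n => (k : ℕ))
        (fun _ _ _ _ h => Fin.ext h)]
    refine Finset.sum_le_sum_of_subset_of_nonneg (fun x hx => ?_) fun _ _ _ => by positivity
    obtain ⟨k, hk, rfl⟩ := Finset.mem_image.1 hx
    obtain ⟨hkA, hkq⟩ := Finset.mem_filter.1 hk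
    have h2 := hA k hkA
    rw [h, h, if_pos hkq, if_pos hiq] at h2
    have h3 : (k : ℕ) ≤ i := (pow_le_pow_iff_right₀ (by linarith)).1 (le_of_mul_le_mul_left h2 hc)
    exact Finset.mem_range.2 (lt_of_le_of_ne h3 fun h => hiA (Fin.ext h ▸ hkA))
  have h2 := geom_sum_mul m i
  have h3 : 0 ≤ ∑ x ∈ Finset.range (i : ℕ), m ^ x := Finset.sum_nonneg fun _ _ => by positivity
  rw [← Finset.mul_sum] at h1
  rw [add_zero, h, if_pos hiq]
  calc β * ∑ k ∈ A, received L α a k j ≤ β * (c * ∑ x ∈ Finset.range (i : ℕ), m ^ x) := by gcongr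
    _ = c * (β * ∑ x ∈ Finset.range (i : ℕ), m ^ x) := by ring
    _ ≤ c * m ^ (i : ℕ) := by
        gcongr
        nlinarith

lemma successful_of_single_interferer {a : Profile n Pmax} {i l : Fin n} (hα : 0 < α) (hβ : 1 < β)
    (hν : 0 < ν) (hνβ : ν ^ α = β) (hil : l ≠ i) (hPmax : 1 ≤ Pmax) (hai : a i = Fin.last Pmax)
    (ha : ∀ k, k ≠ i → k ≠ l → a k = 0)
    (hd : ν * dist (L.sender i) (L.receiver i) ≤ dist (L.sender l) (L.receiver i)) :
    Successful L α β 0 a i := by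
  have hne : a i ≠ 0 := hai ▸ fullPower_ne_zero hPmax
  refine decodes_of_forall_others hβ le_rfl hne ?_
  rw [add_zero, Finset.sum_eq_single_of_mem l (by simpa using hil)
    fun k hk hkl => received_eq_zero (ha k (by simpa using hk) hkl)]
  have h1 := Real.rpow_pos_of_pos (L.dist_pos i i) α
  have h2 : β * dist (L.sender i) (L.receiver i) ^ α ≤ dist (L.sender l) (L.receiver i) ^ α := by
    rw [← hνβ, ← Real.mul_rpow hν.le dist_nonneg]
    exact Real.rpow_le_rpow (by positivity) hd hα.le
  refine (mul_le_mul_of_nonneg_left received_le (by linarith)).trans ?_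
  rw [received, hai, Fin.val_last, mul_div_assoc', div_le_div_iff₀ (L.dist_pos l i |>
    fun h => Real.rpow_pos_of_pos h α) h1]
  have : (0 : ℝ) ≤ Pmax := Nat.cast_nonneg _
  nlinarith

end LowerBound

section Plane

variable {x y x' y' : ℝ}

/-- The point of the plane with the given coordinates. -/
noncomputable def point (x y : ℝ) : Plane := !₂[x, y]

lemma dist_point : dist (point x y) (point x' y') = √((x - x') ^ 2 + (y - y') ^ 2) := by
  simp [point, EuclideanSpace.dist_eq, Real.dist_eq]

lemma abs_sub_fst_le_dist : |x - x'| ≤ dist (point x y) (point x' y') := by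
  rw [dist_point]
  exact Real.abs_le_sqrt (by nlinarith [sq_nonneg (y - y')])

lemma dist_point_horizontal : dist (point x y) (point x' y) = |x - x'| := by
  rw [dist_point, sub_self, zero_pow two_ne_zero, add_zero, Real.sqrt_sq_eq_abs]

lemma dist_point_vertical : dist (point x y) (point x y') = |y - y'| := by
  rw [dist_point, sub_self, zero_pow two_ne_zero, zero_add, Real.sqrt_sq_eq_abs]

lemma point_injective (h : point x y = point x' y') : x = x' ∧ y = y' := by
  constructor
  · simpa [point] using congrFun (congrArg (fun p : Plane => (p : Fin 2 → ℝ)) h) 0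
  · simpa [point] using congrFun (congrArg (fun p : Plane => (p : Fin 2 → ℝ)) h) 1

end Plane

/-! ### Chains of lengths -/

section Instances

variable {Pmax : ℕ} {α β ν Δ : ℝ}

/-- Two links of lengths `1` and `Δ`, far apart from each other, both succeed at full power. -/
lemma exists_linkSet_two (hα : 0 < α) (hβ : 1 < β) (hν1 : 1 ≤ ν) (hνβ : ν ^ α = β) (hΔ : 1 ≤ Δ)
    (hPmax : 1 ≤ Pmax) {x : ℝ} (hx : x ≤ 1 / 3) :
    ∃ (n : ℕ) (L : LinkSet n), Function.Injective L.link ∧ L.Delta = Δ ∧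
      ∀ ε : ℝ, 0 ≤ ε → ENNReal.ofReal x ≤ priceOfTotalAnarchy L α β 0 Pmax ε := by
  have hνΔ : 1 ≤ ν * Δ := one_le_mul_of_one_le_of_one_le hν1 hΔ
  set d : ℝ := 1 + ν * Δ with hd
  let S : Fin 2 → Plane := ![point 0 0, point d 0]
  let R : Fin 2 → Plane := ![point 1 0, point (d + Δ) 0]
  have h00 : dist (S 0) (R 0) = 1 := by simp [S, R, dist_point_horizontal]
  have h01 : dist (S 0) (R 1) = d + Δ := by
    change dist (point 0 0) (point (d + Δ) 0) = _
    rw [dist_point_horizontal, zero_sub, abs_neg, abs_of_pos (by linarith)]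
  have h10 : dist (S 1) (R 0) = ν * Δ := by
    change dist (point d 0) (point 1 0) = _
    rw [dist_point_horizontal, hd, add_sub_cancel_left, abs_of_pos (by linarith)]
  have h11 : dist (S 1) (R 1) = Δ := by
    change dist (point d 0) (point (d + Δ) 0) = _
    rw [dist_point_horizontal, sub_add_cancel_left, abs_neg, abs_of_pos (by linarith)]
  let L : LinkSet 2 :=
    { sender := S
      receiver := R
      one_le_dist := by
        intro i j
        fin_cases i <;> fin_cases j
        · exact h00.ge
        · exact h01.ge.trans' (by linarith)
        · exact h10.ge.trans' (by linarith)
        · exact h11.ge.trans' hΔ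
      exists_dist_eq_one := ⟨0, 0, h00⟩ }
  let a : Profile 2 Pmax := fun _ => Fin.last Pmax
  have hsucc : ∀ i, Successful L α β 0 a i := by
    intro i
    fin_cases i
    · refine successful_of_single_interferer (l := 1) hα hβ (by linarith) hνβ (by simp) hPmax rfl
        (fun k h0 h1 => ?_) (h10.ge.trans' ?_)
      · fin_cases k
        · exact absurd rfl h0
        · exact absurd rfl h1
      · change ν * dist (S 0) (R 0) ≤ _
        rw [h00]
        nlinarith
    · refine successful_of_single_interferer (l := 0) hα hβ (by linarith) hνβ (by simp) hPmax rfl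
        (fun k h1 h0 => ?_) (h01.ge.trans' ?_)
      · fin_cases k
        · exact absurd rfl h0
        · exact absurd rfl h1
      · change ν * dist (S 1) (R 1) ≤ _
        rw [h11]
        linarith
  refine ⟨2, L, ?_, ?_, fun ε hε => ?_⟩
  · intro i j hij
    have hS : S i = S j := congrArg Prod.fst hij
    have h0d : S 0 ≠ S 1 := fun h => by
      have := (point_injective h).1
      linarith
    fin_cases i <;> fin_cases j
    · rfl
    · exact absurd hS h0d
    · exact absurd hS.symm h0d
    · rfl
  · refine le_antisymm (ciSup_le fun i => ?_) (h11.ge.trans (L.length_le_Delta 1))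
    fin_cases i
    · exact h00.le.trans hΔ
    · exact h11.le
  · refine le_priceOfTotalAnarchy (T := 1) (H := fun _ => a) (B := Finset.univ) (a := a) (q := 2)
      one_pos hε (fun i y => Finset.sum_le_sum fun t _ => ?_) (by simp) (by simp)
      (le_numSuccessful le_rfl fun i _ => hsucc i) (by norm_num; linarith)
    have : utility L α β 0 a i = 1 := by
      rw [utility, if_neg (hsucc i).ne_zero, if_pos (hsucc i)]
    rw [this]
    exact utility_le_one

/-- If two other signals of at least the strength that `i` can reach tie at its receiver, then `i`
fails with every positive power. -/
lemma utility_update_of_tie {n : ℕ} {L : LinkSet n} {a : Profile n Pmax} {i k l : Fin n}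
    {y : Fin (Pmax + 1)} (hβ : 1 < β) (hki : k ≠ i) (hli : l ≠ i) (hkl : k ≠ l) (hk : a k ≠ 0)
    (heq : received L α a k i = received L α a l i)
    (hle : Pmax / dist (L.sender i) (L.receiver i) ^ α ≤ received L α a k i) :
    utility L α β 0 (Function.update a i y) i = if y = 0 then 0 else -1 := by
  have e : ∀ x, x ≠ i → received L α (Function.update a i y) x i = received L α a x i :=
    fun x hx => by rw [received, Function.update_of_ne hx, received]
  have hfail : ¬ Successful L α β 0 (Function.update a i y) i := by
    refine not_decodes_of_tie hβ le_rfl hkl ?_ ?_ ?_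
    · rw [e k hki, e l hli, heq]
    · rw [e k hki]
      exact received_pos hk
    · rw [e k hki]
      exact received_le.trans hle
  rw [utility, Function.update_self, if_neg hfail]

/-- Many links of geometrically growing lengths at least `ν` have a common receiver, where their
signals can all be decoded. Two further links of length `1`, with senders at distance `ν` from this
receiver, always succeed at full power; then their signals tie at the common receiver and block the
other links, so that this is an equilibrium. -/
lemma exists_linkSet_lengths (hα : 0 < α) (hβ : 1 < β) (hν1 : 1 ≤ ν) (hνβ : ν ^ α = β)
    (hΔ : 1 ≤ Δ) (hPmax : 1 ≤ Pmax) {m μ : ℝ} (hm : β + 1 ≤ m) (hμ : 1 < μ) (hμm : μ ^ α = m)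
    {q : ℕ} (hq : ν ≤ Δ / μ ^ q) {x : ℝ} (hx : x ≤ (q + 1) / 6) :
    ∃ (n : ℕ) (L : LinkSet n), Function.Injective L.link ∧ L.Delta = Δ ∧
      ∀ ε : ℝ, 0 ≤ ε → ENNReal.ofReal x ≤ priceOfTotalAnarchy L α β 0 Pmax ε := by
  set D : ℕ → ℝ := fun k => Δ / μ ^ k with hD
  have hD1 : ∀ k, k < q + 1 → ν ≤ D k := fun k hk => hq.trans (by
    have : μ ^ k ≤ μ ^ q := pow_le_pow_right₀ hμ.le (by omega)
    have : 0 < μ ^ k := by positivity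
    simp only [hD]
    gcongr)
  have hDΔ : ∀ k, D k ≤ Δ := fun k => div_le_self (by linarith) (one_le_pow₀ hμ.le)
  -- The links up to `q` form the chain; `q + 1` and `q + 2` are the blocking links.
  let S : ℕ → Plane := fun k =>
    if k < q + 1 then point 0 (D k) else if k = q + 1 then point ν 0 else point (-ν) 0
  let R : ℕ → Plane := fun k =>
    if k < q + 1 then point 0 0 else if k = q + 1 then point (ν + 1) 0 else point (-(ν + 1)) 0
  have hSm : ∀ k, k < q + 1 → S k = point 0 (D k) := fun k hk => if_pos hk
  have hRm : ∀ k, k < q + 1 → R k = point 0 0 := fun k hk => if_pos hk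
  have hS1 : S (q + 1) = point ν 0 := by simp [S]
  have hS2 : S (q + 2) = point (-ν) 0 := by simp [S]
  have hR1 : R (q + 1) = point (ν + 1) 0 := by simp [R]
  have hR2 : R (q + 2) = point (-(ν + 1)) 0 := by simp [R]
  have hcases : ∀ k : Fin (q + 3), (k : ℕ) < q + 1 ∨ (k : ℕ) = q + 1 ∨ (k : ℕ) = q + 2 := by
    intro k
    omega
  have dmm : ∀ i j, i < q + 1 → j < q + 1 → dist (S i) (R j) = D i := fun i j hi hj => by
    rw [hSm i hi, hRm j hj, dist_point_vertical, sub_zero, abs_of_pos]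
    linarith [hD1 i hi]
  have d1m : ∀ j, j < q + 1 → dist (S (q + 1)) (R j) = ν := fun j hj => by
    rw [hS1, hRm j hj, dist_point_horizontal, sub_zero, abs_of_pos (by linarith)]
  have d2m : ∀ j, j < q + 1 → dist (S (q + 2)) (R j) = ν := fun j hj => by
    rw [hS2, hRm j hj, dist_point_horizontal, sub_zero, abs_neg, abs_of_pos (by linarith)]
  have d11 : dist (S (q + 1)) (R (q + 1)) = 1 := by
    rw [hS1, hR1, dist_point_horizontal, sub_add_cancel_left, abs_neg, abs_one]
  have d22 : dist (S (q + 2)) (R (q + 2)) = 1 := by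
    rw [hS2, hR2, dist_point_horizontal, show -ν - -(ν + 1) = 1 by ring, abs_one]
  have d12 : dist (S (q + 1)) (R (q + 2)) = 2 * ν + 1 := by
    rw [hS1, hR2, dist_point_horizontal, show ν - -(ν + 1) = 2 * ν + 1 by ring,
      abs_of_pos (by linarith)]
  have d21 : dist (S (q + 2)) (R (q + 1)) = 2 * ν + 1 := by
    rw [hS2, hR1, dist_point_horizontal, show -ν - (ν + 1) = -(2 * ν + 1) by ring, abs_neg,
      abs_of_pos (by linarith)]
  have dm1 : ∀ i, i < q + 1 → 1 ≤ dist (S i) (R (q + 1)) := fun i hi => by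
    rw [hSm i hi, hR1]
    refine le_trans ?_ abs_sub_fst_le_dist
    rw [zero_sub, abs_neg, abs_of_pos (by linarith)]
    linarith
  have dm2 : ∀ i, i < q + 1 → 1 ≤ dist (S i) (R (q + 2)) := fun i hi => by
    rw [hSm i hi, hR2]
    refine le_trans ?_ abs_sub_fst_le_dist
    rw [zero_sub, neg_neg, abs_of_pos (by linarith)]
    linarith
  let L : LinkSet (q + 3) :=
    { sender := fun k => S k
      receiver := fun k => R k
      one_le_dist := by
        intro i j
        rcases hcases i with hi | hi | hi <;> rcases hcases j with hj | hj | hj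
        · rw [dmm _ _ hi hj]
          linarith [hD1 i hi]
        · rw [hj]
          exact dm1 _ hi
        · rw [hj]
          exact dm2 _ hi
        · rw [hi, d1m _ hj]
          exact hν1
        · rw [hi, hj, d11]
        · rw [hi, hj, d12]
          linarith
        · rw [hi, d2m _ hj]
          exact hν1
        · rw [hi, hj, d21]
          linarith
        · rw [hi, hj, d22]
      exists_dist_eq_one := ⟨⟨q + 1, by omega⟩, ⟨q + 1, by omega⟩, d11⟩ }
  have hlast := fullPower_ne_zero hPmax
  let k₁ : Fin (q + 3) := ⟨q + 1, by omega⟩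
  let k₂ : Fin (q + 3) := ⟨q + 2, by omega⟩
  have hk₁₂ : k₁ ≠ k₂ := fun h => by simpa [k₁, k₂] using congrArg Fin.val h
  -- The equilibrium `b` and the profile `a` in which the whole chain succeeds.
  let b : Profile (q + 3) Pmax := fun k => if (k : ℕ) < q + 1 then 0 else Fin.last Pmax
  let a : Profile (q + 3) Pmax := fun k => if (k : ℕ) < q + 1 then Fin.last Pmax else 0
  have hbm : ∀ k, k ≠ k₁ → k ≠ k₂ → b k = 0 := fun k h1 h2 => by
    rcases hcases k with hk | hk | hk
    · exact if_pos hk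
    · exact absurd (Fin.ext hk) h1
    · exact absurd (Fin.ext hk) h2
  have hb₁ : b k₁ = Fin.last Pmax := if_neg (by simp [k₁])
  have hb₂ : b k₂ = Fin.last Pmax := if_neg (by simp [k₂])
  have hsb₁ : Successful L α β 0 b k₁ := by
    refine successful_of_single_interferer (l := k₂) hα hβ (by linarith) hνβ hk₁₂.symm hPmax hb₁
      hbm (d21.ge.trans' ?_)
    change ν * dist (S (q + 1)) (R (q + 1)) ≤ _
    rw [d11]
    linarith
  have hsb₂ : Successful L α β 0 b k₂ := by
    refine successful_of_single_interferer (l := k₁) hα hβ (by linarith) hνβ hk₁₂ hPmax hb₂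
      (fun k h2 h1 => hbm k h1 h2) (d12.ge.trans' ?_)
    change ν * dist (S (q + 2)) (R (q + 2)) ≤ _
    rw [d22]
    linarith
  refine ⟨q + 3, L, ?_, ?_, fun ε hε => ?_⟩
  · intro i j hij
    have hS : S i = S j := congrArg Prod.fst hij
    have inj : ∀ k, k < q + 1 → S k ≠ S (q + 1) ∧ S k ≠ S (q + 2) := by
      intro k hk
      rw [hSm k hk, hS1, hS2]
      constructor <;> intro h <;> linarith [(point_injective h).1]
    have h12 : S (q + 1) ≠ S (q + 2) := by
      rw [hS1, hS2]
      intro h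
      linarith [(point_injective h).1]
    apply Fin.ext
    rcases hcases i with hi | hi | hi <;> rcases hcases j with hj | hj | hj
    · rw [hSm _ hi, hSm _ hj] at hS
      have h1 : Δ / μ ^ (i : ℕ) = Δ / μ ^ (j : ℕ) := (point_injective hS).2
      have hΔ0 : Δ ≠ 0 := by linarith
      rw [div_eq_div_iff (by positivity) (by positivity)] at h1
      exact pow_right_injective₀ (by linarith) hμ.ne' (mul_left_cancel₀ hΔ0 h1).symm
    · exact absurd (hj ▸ hS) (inj _ hi).1
    · exact absurd (hj ▸ hS) (inj _ hi).2
    · exact absurd (hi ▸ hS).symm (inj _ hj).1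
    · rw [hi, hj]
    · rw [hi, hj] at hS
      exact absurd hS h12
    · exact absurd (hi ▸ hS).symm (inj _ hj).2
    · rw [hi, hj] at hS
      exact absurd hS.symm h12
    · rw [hi, hj]
  · refine le_antisymm (ciSup_le fun i => ?_) ?_
    · change dist (S i) (R i) ≤ Δ
      rcases hcases i with hi | hi | hi
      · rw [dmm _ _ hi hi]
        exact hDΔ _
      · rw [hi, d11]
        exact hΔ
      · rw [hi, d22]
        exact hΔ
    · have h0 : dist (S 0) (R 0) = Δ := by
        rw [dmm 0 0 (by omega) (by omega)]
        simp [hD]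
      exact h0.ge.trans (L.length_le_Delta 0)
  · refine le_priceOfTotalAnarchy (T := 1) (H := fun _ => b) (B := {k₁, k₂}) (a := a) (q := q + 1)
      one_pos hε (fun i y => Finset.sum_le_sum fun t _ => ?_) ?_ ?_
      (le_numSuccessful (by omega) fun i hi => ?_) (by push_cast; exact hx)
    · have hone : Successful L α β 0 b i → utility L α β 0 (Function.update b i y) i
          ≤ utility L α β 0 b i := fun h => by
        rw [show utility L α β 0 b i = 1 by rw [utility, if_neg h.ne_zero, if_pos h]]
        exact utility_le_one
      rcases hcases i with hi | hi | hi
      · have h1 : received L α b k₁ i = Pmax / ν ^ α := by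
          rw [received, hb₁, Fin.val_last]
          change (Pmax : ℝ) / dist (S (q + 1)) (R i) ^ α = _
          rw [d1m _ hi]
        have h2 : received L α b k₂ i = Pmax / ν ^ α := by
          rw [received, hb₂, Fin.val_last]
          change (Pmax : ℝ) / dist (S (q + 2)) (R i) ^ α = _
          rw [d2m _ hi]
        rw [utility_update_of_tie hβ (k := k₁) (l := k₂)
          (fun h => by rw [← h] at hi; simp [k₁] at hi)
          (fun h => by rw [← h] at hi; simp [k₂] at hi) hk₁₂ (by rw [hb₁]; exact hlast)
          (h1.trans h2.symm) (by
            rw [h1]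
            change (Pmax : ℝ) / dist (S i) (R i) ^ α ≤ _
            rw [dmm _ _ hi hi]
            have := hD1 i hi
            gcongr),
          utility, if_pos (show b i = 0 from if_pos hi)]
        split_ifs <;> norm_num
      · exact hone (by rwa [show i = k₁ from Fin.ext hi])
      · exact hone (by rwa [show i = k₂ from Fin.ext hi])
    · exact Finset.card_le_two.trans (by norm_num)
    · intro t k hk
      simp only [Finset.mem_insert, Finset.mem_singleton, not_or] at hk
      exact hbm k hk.1 hk.2
    · refine decodes_of_geometric (m := m) (c := Pmax / Δ ^ α) (q := q + 1) hβ hm ?_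
        (fun k => ?_) hi
      · have : (0 : ℝ) < Pmax := by exact_mod_cast hPmax
        have : 0 < Δ := by linarith
        positivity
      · by_cases hk : (k : ℕ) < q + 1
        · rw [if_pos hk, received, show a k = Fin.last Pmax from if_pos hk, Fin.val_last]
          change (Pmax : ℝ) / dist (S k) (R i) ^ α = _
          rw [dmm _ _ hk hi]
          simp only [hD]
          rw [Real.div_rpow (by linarith) (by positivity), ← hμm, ← Real.rpow_natCast,
            ← Real.rpow_natCast, ← Real.rpow_mul (by linarith), ← Real.rpow_mul (by linarith),
            mul_comm α]
          have : 0 < μ ^ ((k : ℕ) * α) := Real.rpow_pos_of_pos (by linarith) _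
          have : 0 < Δ ^ α := Real.rpow_pos_of_pos (by linarith) _
          field_simp
        · rw [if_neg hk, received_eq_zero (show a k = 0 from if_neg hk)]

end Instances

/-! ### Chains of powers, and the lower bound -/

section Powers

variable {Pmax : ℕ} {α β Δ : ℝ}

/-- The links below `q` use geometrically growing powers; the others are silent. -/
def geometricProfile (n Pmax m q : ℕ) : Profile n Pmax := fun k =>
  if (k : ℕ) < q then ⟨min (m ^ (k : ℕ)) Pmax, Nat.lt_succ_iff.2 (min_le_right _ _)⟩ else 0

/-- In round `t` the links `2 * t` and `2 * t + 1` use full power; the others are silent. -/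
def pairProfile (n Pmax t : ℕ) : Profile n Pmax := fun k =>
  if (k : ℕ) / 2 = t then Fin.last Pmax else 0

/-- At least six links with a common receiver and, except for one, of length `1` can all be
decoded if their powers grow geometrically. In the history, each of the pairs `(0, 1)`, `(2, 3)`
and `(4, 5)` blocks all other links in one round, and all six of these links succeed in a fourth
round. In hindsight every fixed positive power fails in two of the four rounds at least, so that
no link regrets its play. -/
lemma exists_linkSet_powers (hβ : 1 < β) (hΔ : 1 ≤ Δ) {m : ℕ} (hm : β + 1 ≤ m) (hα : 0 < α) {n : ℕ}
    (hn : 6 ≤ n) (hmn : m ^ (n - 1) ≤ Pmax) {x : ℝ} (hx : x ≤ n / 6) :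
    ∃ (n : ℕ) (L : LinkSet n), Function.Injective L.link ∧ L.Delta = Δ ∧
      ∀ ε : ℝ, 0 ≤ ε → ENNReal.ofReal x ≤ priceOfTotalAnarchy L α β 0 Pmax ε := by
  have hm1 : 1 ≤ m := by
    have : (1 : ℝ) ≤ m := by linarith
    exact_mod_cast this
  have hPmax : 1 ≤ Pmax := (Nat.one_le_pow _ _ hm1).trans hmn
  have hlast := fullPower_ne_zero hPmax
  -- The senders lie in distinct directions from the common receiver. Link `n` only serves to make
  -- the maximal length equal to `Δ`.
  set τ : ℕ → ℝ := fun k => 1 / (k + 1) with hτ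
  have hτ0 : ∀ k, 0 < τ k := fun k => by positivity
  have hτ1 : ∀ k, τ k ≤ 1 := fun k =>
    div_le_one_of_le₀ (by linarith [(Nat.cast_nonneg k : (0 : ℝ) ≤ k)]) (by positivity)
  set D : ℕ → ℝ := fun k => if k < n then 1 else Δ with hD
  have hDlt : ∀ k, k < n → D k = 1 := fun k hk => if_pos hk
  have hD1 : ∀ k, 1 ≤ D k := fun k => by
    simp only [hD]
    split_ifs
    · exact le_rfl
    · exact hΔ
  let S : ℕ → Plane := fun k => point (D k * √(1 - τ k ^ 2)) (D k * τ k)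
  have hdist : ∀ k, dist (S k) (point 0 0) = D k := by
    intro k
    have h1 : 0 ≤ 1 - τ k ^ 2 := by nlinarith [hτ0 k, hτ1 k]
    rw [dist_point, sub_zero, sub_zero, mul_pow, mul_pow, Real.sq_sqrt h1, ← mul_add,
      sub_add_cancel, mul_one, Real.sqrt_sq (by linarith [hD1 k])]
  let L : LinkSet (n + 1) :=
    { sender := fun k => S k
      receiver := fun _ => point 0 0
      one_le_dist := fun i _ => (hdist i).ge.trans' (hD1 i)
      exists_dist_eq_one := ⟨0, 0, (hdist _).trans (hDlt _ (by simp; omega))⟩ }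
  have hrec : ∀ (b : Profile (n + 1) Pmax) (k j : Fin (n + 1)), (k : ℕ) < n →
      received L α b k j = ((b k : ℕ) : ℝ) := by
    intro b k j hk
    change ((b k : ℕ) : ℝ) / dist (S k) (point 0 0) ^ α = _
    rw [hdist, hDlt _ hk, Real.one_rpow, div_one]
  have hgeom : ∀ q, q ≤ n → ∀ i : Fin (n + 1), (i : ℕ) < q →
      Successful L α β 0 (geometricProfile (n + 1) Pmax m q) i := by
    intro q hq i hi
    refine decodes_of_geometric (m := m) (c := 1) (q := q) hβ hm one_pos (fun k => ?_) hi
    by_cases hk : (k : ℕ) < q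
    · have h1 : m ^ (k : ℕ) ≤ Pmax := (Nat.pow_le_pow_right hm1 (by omega)).trans hmn
      rw [hrec _ _ _ (by omega), if_pos hk, geometricProfile, if_pos hk, one_mul, Fin.val_mk,
        min_eq_left h1, Nat.cast_pow]
    · rw [if_neg hk, received_eq_zero (show geometricProfile (n + 1) Pmax m q k = 0 from if_neg hk)]
  let H : Fin 4 → Profile (n + 1) Pmax := fun t =>
    if (t : ℕ) < 3 then pairProfile (n + 1) Pmax t else geometricProfile (n + 1) Pmax m 6
  refine ⟨n + 1, L, ?_, ?_, fun ε hε => ?_⟩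
  · intro i j hij
    have hS : S i = S j := congrArg Prod.fst hij
    have h1 : D i = D j := by rw [← hdist i, ← hdist j, hS]
    have h2 : D i * τ i = D j * τ j := (point_injective hS).2
    have hDj := hD1 j
    rw [h1] at h2
    have h3 : 1 / (((i : ℕ) : ℝ) + 1) = 1 / (((j : ℕ) : ℝ) + 1) :=
      mul_left_cancel₀ (by linarith) h2
    rw [div_eq_div_iff (by positivity) (by positivity)] at h3
    apply Fin.ext
    have h4 : ((i : ℕ) : ℝ) = ((j : ℕ) : ℝ) := by linarith
    exact_mod_cast h4
  · have hlen : ∀ i : Fin (n + 1), dist (L.sender i) (L.receiver i) = D i := fun i => hdist i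
    refine le_antisymm (ciSup_le fun i => ?_) ?_
    · rw [hlen]
      simp only [hD]
      split_ifs
      · exact hΔ
      · exact le_rfl
    · have h := L.length_le_Delta (Fin.last n)
      rw [hlen, Fin.val_last] at h
      simpa [hD] using h
  · refine le_priceOfTotalAnarchy (T := 4) (H := H) (B := Finset.univ.filter fun k => (k : ℕ) < 6)
      (a := geometricProfile (n + 1) Pmax m n) (q := n) (by norm_num) hε (fun i y => ?_) ?_ ?_
      (le_numSuccessful (by omega) (hgeom n le_rfl)) hx
    · have hzero : ∀ a : Profile (n + 1) Pmax, a i = 0 → utility L α β 0 a i = 0 := fun a ha =>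
        if_pos ha
      have hone : ∀ a : Profile (n + 1) Pmax, -1 ≤ utility L α β 0 a i := fun a => by
        unfold utility
        split_ifs <;> norm_num
      have hpair : ∀ t, t < 3 → (i : ℕ) / 2 ≠ t →
          utility L α β 0 (Function.update (pairProfile (n + 1) Pmax t) i y) i
            = if y = 0 then 0 else -1 := by
        intro t ht hit
        have hk : ∀ k : Fin (n + 1), (k : ℕ) / 2 = t →
            received L α (pairProfile (n + 1) Pmax t) k i = Pmax := fun k hk => by
          rw [hrec _ _ _ (by omega), pairProfile, if_pos hk, Fin.val_last]
        have h0 : 2 * t / 2 = t := by omega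
        have h1 : (2 * t + 1) / 2 = t := by omega
        refine utility_update_of_tie hβ (k := ⟨2 * t, by omega⟩) (l := ⟨2 * t + 1, by omega⟩)
          (fun h => hit (by rw [← h]; exact h0)) (fun h => hit (by rw [← h]; exact h1))
          (fun h => by simpa using congrArg Fin.val h) ?_ ?_ ?_
        · rw [pairProfile, if_pos h0]
          exact hlast
        · rw [hk _ h0, hk _ h1]
        · rw [hk _ h0]
          exact div_le_self (Nat.cast_nonneg _)
            (Real.one_le_rpow (L.one_le_dist i i) hα.le)
      have hsilent : ∀ t, (i : ℕ) / 2 ≠ t → utility L α β 0 (pairProfile (n + 1) Pmax t) i = 0 :=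
        fun t ht => hzero _ (if_neg ht)
      have hH : ∀ f : Profile (n + 1) Pmax → ℝ, ∑ t, f (H t) = f (pairProfile _ _ 0)
          + f (pairProfile _ _ 1) + f (pairProfile _ _ 2) + f (geometricProfile _ _ m 6) :=
        fun f => Fin.sum_univ_four _
      rw [hH fun a => utility L α β 0 (Function.update a i y) i, hH fun a => utility L α β 0 a i]
      -- The three pair rounds fail with every positive power, except possibly the one in which `i`
      -- itself is in the pair.
      have hdev : utility L α β 0 (Function.update (pairProfile (n + 1) Pmax 0) i y) i
          + utility L α β 0 (Function.update (pairProfile (n + 1) Pmax 1) i y) i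
          + utility L α β 0 (Function.update (pairProfile (n + 1) Pmax 2) i y) i
          + utility L α β 0 (Function.update (geometricProfile (n + 1) Pmax m 6) i y) i ≤ 0 := by
        by_cases hy : y = 0
        · rw [hzero _ (by rw [Function.update_self, hy]),
            hzero _ (by rw [Function.update_self, hy]),
            hzero _ (by rw [Function.update_self, hy]), hzero _ (by rw [Function.update_self, hy])]
          norm_num
        · simp only [hy, if_false] at hpair
          have u : ∀ a : Profile (n + 1) Pmax, utility L α β 0 a i ≤ 1 := fun a => utility_le_one
          have u0 := u (Function.update (pairProfile (n + 1) Pmax 0) i y)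
          have u1 := u (Function.update (pairProfile (n + 1) Pmax 1) i y)
          have u2 := u (Function.update (pairProfile (n + 1) Pmax 2) i y)
          have u3 := u (Function.update (geometricProfile (n + 1) Pmax m 6) i y)
          by_cases h0 : (i : ℕ) / 2 = 0
          · linarith [hpair 1 (by norm_num) (by omega), hpair 2 (by norm_num) (by omega)]
          · by_cases h1 : (i : ℕ) / 2 = 1
            · linarith [hpair 0 (by norm_num) h0, hpair 2 (by norm_num) (by omega)]
            · linarith [hpair 0 (by norm_num) h0, hpair 1 (by norm_num) h1]
      -- The links of the pairs fail at most once and succeed in the last round.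
      refine hdev.trans ?_
      by_cases hi : (i : ℕ) < 6
      · have hs := hgeom 6 hn i hi
        have h3 : utility L α β 0 (geometricProfile (n + 1) Pmax m 6) i = 1 := by
          rw [utility, if_neg hs.ne_zero, if_pos hs]
        have g0 := hone (pairProfile (n + 1) Pmax 0)
        have g1 := hone (pairProfile (n + 1) Pmax 1)
        have g2 := hone (pairProfile (n + 1) Pmax 2)
        by_cases h0 : (i : ℕ) / 2 = 0
        · linarith [hsilent 1 (by omega), hsilent 2 (by omega)]
        · by_cases h1 : (i : ℕ) / 2 = 1
          · linarith [hsilent 0 h0, hsilent 2 (by omega)]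
          · linarith [hsilent 0 h0, hsilent 1 h1]
      · rw [hsilent 0 (by omega), hsilent 1 (by omega), hsilent 2 (by omega),
          hzero _ (if_neg hi)]
        norm_num
    · have h : (Finset.univ.filter fun k : Fin (n + 1) => (k : ℕ) < 6)
          ⊆ Finset.univ.image (Fin.castLE (show 6 ≤ n + 1 by omega)) := by
        intro k hk
        exact Finset.mem_image.2 ⟨⟨k, (Finset.mem_filter.1 hk).2⟩, Finset.mem_univ _, rfl⟩
      exact (Finset.card_le_card h).trans (Finset.card_image_le.trans (by simp))
    · intro t k hk
      have hk6 : ¬ (k : ℕ) < 6 := by simpa using hk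
      simp only [H]
      split_ifs with ht
      · exact if_neg (by omega)
      · exact if_neg hk6

end Powers

section Combination

/-- The long chain of signal strengths in the hard instances comes from the lengths if `Δ` dominates
and from the powers if `Pmax` dominates. -/
lemma exists_linkSet_le_priceOfTotalAnarchy {α β : ℝ} (hα : 0 < α) (hβ : 1 < β) :
    ∃ c > (0 : ℝ), ∀ (Δ : ℝ) (Pmax : ℕ), 1 ≤ Δ → 1 ≤ Pmax →
      ∃ (n : ℕ) (L : LinkSet n), Function.Injective L.link ∧ L.Delta = Δ ∧
        ∀ ε : ℝ, 0 ≤ ε → ENNReal.ofReal (c * (1 + Real.log (Δ * Pmax))) ≤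
          priceOfTotalAnarchy L α β 0 Pmax ε := by
  obtain ⟨m, hm⟩ := exists_nat_ge (β + 1)
  have hm1 : (1 : ℝ) < m := by linarith
  set ν : ℝ := β ^ (1 / α) with hν
  set μ : ℝ := (m : ℝ) ^ (1 / α) with hμ
  have hνβ : ν ^ α = β := by
    rw [hν, ← Real.rpow_mul (by linarith), one_div_mul_cancel hα.ne', Real.rpow_one]
  have hμm : μ ^ α = m := by
    rw [hμ, ← Real.rpow_mul (by linarith), one_div_mul_cancel hα.ne', Real.rpow_one]
  have hν1 : 1 ≤ ν := Real.one_le_rpow hβ.le (by positivity)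
  have hμ1 : 1 < μ := Real.one_lt_rpow hm1 (by positivity)
  have lν := Real.log_nonneg hν1
  have lμ := Real.log_nonneg hμ1.le
  have lm := Real.log_nonneg hm1.le
  set K : ℝ := 1 + 2 * Real.log ν + 2 * Real.log μ + 10 * Real.log m with hK
  have hK0 : 0 < K := by positivity
  refine ⟨1 / (6 * K), by positivity, fun Δ Pmax hΔ hPmax => ?_⟩
  have hP1 : (1 : ℝ) ≤ Pmax := by exact_mod_cast hPmax
  have hx : ∀ q : ℝ, 1 + Real.log (Δ * Pmax) ≤ q * K →
      1 / (6 * K) * (1 + Real.log (Δ * Pmax)) ≤ q / 6 := by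
    intro q hq
    rw [one_div, inv_mul_le_iff₀ (by positivity)]
    linarith
  have hlog : Real.log (Δ * Pmax) = Real.log Δ + Real.log Pmax :=
    Real.log_mul (by linarith) (by linarith)
  rcases le_total (Pmax : ℝ) Δ with hle | hle
  · have l1 : Real.log Pmax ≤ Real.log Δ := Real.log_le_log (by linarith) hle
    by_cases hνΔ : ν ≤ Δ
    · obtain ⟨q, hq, hq'⟩ := exists_nat_pow_near (x := Δ / ν)
        ((one_le_div (by linarith)).2 hνΔ) hμ1
      have hμq : 0 < μ ^ q := by positivity
      refine exists_linkSet_lengths hα hβ hν1 hνβ hΔ hPmax hm hμ1 hμm (q := q) ?_ (hx (q + 1) ?_)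
      · rw [le_div_iff₀ (by linarith)] at hq
        rw [le_div_iff₀ hμq]
        linarith
      · have l2 : Real.log Δ - Real.log ν ≤ (q + 1) * Real.log μ := by
          rw [← Real.log_div (by linarith) (by linarith)]
          refine (Real.log_le_log (by positivity) hq'.le).trans (le_of_eq ?_)
          rw [Real.log_pow]
          push_cast
          ring
        have hq0 : (0 : ℝ) ≤ q := Nat.cast_nonneg q
        have e : ((q : ℝ) + 1) * K = K + 2 * (q * Real.log μ)
            + q * (1 + 2 * Real.log ν + 10 * Real.log m) := by
          rw [hK]
          ring
        have h3 : 0 ≤ q * (1 + 2 * Real.log ν + 10 * Real.log m) := by positivity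
        rw [hlog, e, hK]
        linarith
    · have l2 : Real.log Δ ≤ Real.log ν := Real.log_le_log (by linarith) (not_le.1 hνΔ).le
      refine exists_linkSet_two hα hβ hν1 hνβ hΔ hPmax ((hx 2 ?_).trans (by norm_num))
      rw [hlog]
      linarith
  · have l1 : Real.log Δ ≤ Real.log Pmax := Real.log_le_log (by linarith) hle
    by_cases h5 : (m : ℝ) ^ 5 ≤ Pmax
    · obtain ⟨q, hq, hq'⟩ := exists_nat_pow_near hP1 hm1
      have hq5 : 5 < q + 1 := (pow_lt_pow_iff_right₀ hm1).1 (h5.trans_lt hq')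
      refine exists_linkSet_powers hβ hΔ hm hα (n := q + 1) hq5 (by exact_mod_cast hq) (hx _ ?_)
      have l2 : Real.log Pmax ≤ (q + 1) * Real.log m := by
        refine (Real.log_le_log (by linarith) hq'.le).trans (le_of_eq ?_)
        rw [Real.log_pow]
        push_cast
        ring
      have hq0 : (0 : ℝ) ≤ q := Nat.cast_nonneg q
      have e : ((q : ℝ) + 1) * K = (q + 1) * (1 + 2 * Real.log ν + 2 * Real.log μ
          + 8 * Real.log m) + 2 * ((q + 1) * Real.log m) := by
        rw [hK]
        ring
      have h3 : 1 ≤ ((q : ℝ) + 1) * (1 + 2 * Real.log ν + 2 * Real.log μ + 8 * Real.log m) :=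
        one_le_mul_of_one_le_of_one_le (by linarith) (by linarith)
      push_cast
      rw [hlog, e]
      linarith
    · have l2 : Real.log Pmax ≤ 5 * Real.log m := by
        refine (Real.log_le_log (by linarith) (not_le.1 h5).le).trans (le_of_eq ?_)
        rw [Real.log_pow]
        norm_num
      refine exists_linkSet_two hα hβ hν1 hνβ hΔ hPmax ((hx 2 ?_).trans (by norm_num))
      rw [hlog]
      linarith

end Combination

end Wireless

theorem mainTheorem10 (α β : ℝ) (hα : 0 < α) (hβ : 1 < β) :
    (∃ C > (0 : ℝ), ∃ κ > (0 : ℝ),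
      ∀ (n : ℕ) (L : Wireless.LinkSet n) (noise : ℝ) (Pmax : ℕ) (ε : ℝ),
        0 ≤ noise → 1 ≤ Pmax → 0 ≤ ε → ε ≤ κ / n →
          Wireless.priceOfTotalAnarchy L α β noise Pmax ε ≤
            ENNReal.ofReal (C * (1 + Real.log (L.Delta * Pmax)))) ∧
    (∃ c > (0 : ℝ), ∀ (Δ : ℝ) (Pmax : ℕ), 1 ≤ Δ → 1 ≤ Pmax →
      ∃ (n : ℕ) (L : Wireless.LinkSet n), Function.Injective L.link ∧ L.Delta = Δ ∧
        ∀ ε : ℝ, 0 ≤ ε →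
          ENNReal.ofReal (c * (1 + Real.log (Δ * Pmax))) ≤
            Wireless.priceOfTotalAnarchy L α β 0 Pmax ε) := by
  refine ⟨⟨32 * (1 + 4 * Wireless.affectanceConst α β), ?_, 1 / 20, by norm_num,
    fun n L noise Pmax ε hN hP hε hεn => Wireless.priceOfTotalAnarchy_le hα hβ hN hP hε hεn⟩,
    Wireless.exists_linkSet_le_priceOfTotalAnarchy hα hβ⟩
  have := Wireless.affectanceConst_pos hα hβ
  positivity
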